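/- Let $X$ be a real separable Banach space with dual $X^*$. Let $Q:X^*\to X$ be bounded, linear, symmetric and nonnegative ($\langle Qx^*,y^*\rangle=\langle Qy^*,x^*\rangle$, $\langle Qx^*,x^*\rangle\ge 0$), and let $A:D(A)\subseteq X\to X$ be the infinitesimal generator of a strongly continuous contraction semigroup $(e^{tA})_{t\ge 0}$ on $X$. For $t>0$ put $Q_tx^*=\int_0^te^{sA}Qe^{sA^*}x^*\,ds$, and assume that $Q_t$ is the covariance operator of a centred Gaussian measure on $X$ for every $t>0$; that for every $x^*\in X^*$ the weak limit $Q_\infty x^*=\lim_{t\to\infty}Q_tx^*$ exists; and that $Q_\infty$ is the covariance operator of a centred nondegenerate Gaussian measure $\mu_\infty$ on $X$. Let $H$ be the reproducing kernel Hilbert space of $Q$, i.e. the completion of $QX^*$ for the inner product $[Qx^*,Qy^*]_H=\langle Qx^*,y^*\rangle$, with its injection $i:H\to X$ and adjoint $i^*:X^*\to H$, so that $Q=i\circ i^*$; let $H_\infty$, $i_\infty$ and $i_\infty^*$ be the corresponding objects for $Q_\infty$. Regarding $H$ and $H_\infty$ as subspaces of $X$, assume that $i_\infty^*A^*x^*\in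 H$ for all $x^*\in D(A^*)$ and that there is $c>0$ with $|i_\infty^*A^*x^*|_H\le c\,|i^*x^*|_H$ for all $x^*\in D(A^*)$. Let $\mathscr{FC}_b^1(X)$ be the set of functions $f(x)=\varphi(\langle x,x_1^*\rangle,\dots,\langle x,x_n^*\rangle)$ with $n\in\mathbb N$, $x_j^*\in X^*$, and $\varphi\in C^1(\mathbb R^n)$ bounded with bounded first derivatives, and put $$D_Hf(x)=i^*Df(x)=\sum_{j=1}^n\frac{\partial\varphi}{\partial\xi_j}(\langle x,x_1^*\rangle,\dots,\langle x,x_n^*\rangle)\,i^*x_j^*.$$ For $p\in[1,\infty)$ let $W^{1,p}_H(X,\mu_\infty)$ be the set of $f\in L^p(X,\mu_\infty)$ for which there are $f_n\in\mathscr{FC}_b^1(X)$ such that $f_n\to f$ in $L^p(X,\mu_\infty)$ and $(D_Hf_n)$ converges in $L^p(X,\mu_\infty;H)$. Let $U:X\to(-\infty,+\infty]$ be a proper, lower semicontinuous, convex function that belongs to $W^{1,p}_H(X,\mu_\infty)$ for every $p\in[1,\infty)$, and set $\nu_\infty=e^{-U}\mu_\infty$. Then, for every $p\in(1,\infty)$,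 $D_H$ is a well-defined operator from $\mathscr{FC}_b^1(X)\subset L^p(X,\nu_\infty)$ to $L^p(X,\nu_\infty;H)$ and it is closable in $L^p(X,\nu_\infty)$. Denote its closure again by $D_H$, and the domain of the closure by $W^{1,p}_H(X,\nu_\infty)$. For every $p\in(1,\infty)$ the space $W^{1,p}_H(X,\nu_\infty)$ with the norm $$\|f\|_{1,p,H}=\|f\|_{L^p(X,\nu_\infty)}+\|D_Hf\|_{L^p(X,\nu_\infty;H)}$$ is a Banach space, and $W^{1,2}_H(X,\nu_\infty)$ is a Hilbert space with the inner product $$\langle f,g\rangle=\int_Xfg\,d\nu_\infty+\int_X[D_Hf,D_Hg]_H\,d\nu_\infty.$$ -/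

import Mathlib

open MeasureTheory ProbabilityTheory Filter Topology
open scoped NNReal ENNReal

noncomputable section

namespace WeightedOU

/-! ### Strongly continuous contraction semigroups and their generators -/

section Semigroup

variable {X : Type*} [NormedAddCommGroup X] [NormedSpace ℝ X]

/-- `(T t)_{t ≥ 0}` is a strongly continuous semigroup of contractions on `X`. -/
structure IsContractionSemigroup (T : ℝ≥0 → X →L[ℝ] X) : Prop where
  map_zero : T 0 = ContinuousLinearMap.id ℝ X
  map_add : ∀ s t, T (s + t) = (T s).comp (T t)
  norm_le_one : ∀ t, ‖T t‖ ≤ 1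
  strongly_continuous : ∀ x, Continuous fun t => T t x

/-- `A` is the infinitesimal generator of `(T t)_{t ≥ 0}`: one has `x ∈ D(A)` and `A x = y` if and
only if `(T t x - x) / t → y` as `t → 0+`. -/
def IsGenerator (A : X →ₗ.[ℝ] X) (T : ℝ≥0 → X →L[ℝ] X) : Prop :=
  ∀ x y : X, (x, y) ∈ A.graph ↔
    Tendsto (fun t : ℝ≥0 => (t : ℝ)⁻¹ • (T t x - x)) (𝓝[>] 0) (𝓝 y)

/-- `xs ∈ D(A*)` and `A* xs = ys`, where `A*` is the Banach space adjoint of `A`. -/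
def IsAdjointAt (A : X →ₗ.[ℝ] X) (xs ys : StrongDual ℝ X) : Prop :=
  ∀ x : A.domain, xs (A x) = ys x

end Semigroup

/-! ### Nonnegative symmetric operators and reproducing kernel Hilbert spaces -/

/-- A bounded linear operator `X* → X` which is symmetric and nonnegative. -/
structure NonnegSymmOp (X : Type*) [NormedAddCommGroup X] [NormedSpace ℝ X] where
  toCLM : StrongDual ℝ X →L[ℝ] X
  symm : ∀ xs ys : StrongDual ℝ X, ys (toCLM xs) = xs (toCLM ys)
  nonneg : ∀ xs : StrongDual ℝ X, 0 ≤ xs (toCLM xs)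

section RKHS

variable {X : Type*} [NormedAddCommGroup X] [NormedSpace ℝ X]

/-- `X*` with the semi-inner product `(xs, ys) ↦ ⟨F xs, ys⟩`. Its elements of norm zero are those
with `F xs = 0`, so that its separated quotient is `F X*`, with the inner product
`[F xs, F ys] = ⟨F xs, ys⟩`. -/
def PreRKHS (_F : NonnegSymmOp X) : Type _ := StrongDual ℝ X

instance (F : NonnegSymmOp X) : AddCommGroup (PreRKHS F) :=
  inferInstanceAs (AddCommGroup (StrongDual ℝ X))

instance (F : NonnegSymmOp X) : Module ℝ (PreRKHS F) :=
  inferInstanceAs (Module ℝ (StrongDual ℝ X))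

def PreRKHS.of (F : NonnegSymmOp X) : StrongDual ℝ X ≃ₗ[ℝ] PreRKHS F := LinearEquiv.refl ℝ _

@[reducible] def PreRKHS.core (F : NonnegSymmOp X) : PreInnerProductSpace.Core ℝ (PreRKHS F) where
  inner x y := (PreRKHS.of F).symm y (F.toCLM ((PreRKHS.of F).symm x))
  conj_inner_symm x y := by
    simpa using F.symm _ _
  re_inner_nonneg x := by simpa using F.nonneg _
  add_left x y z := by simp
  smul_left x y r := by simp

instance (F : NonnegSymmOp X) : SeminormedAddCommGroup (PreRKHS F) :=
  @InnerProductSpace.Core.toSeminormedAddCommGroup ℝ _ _ _ _ (PreRKHS.core F)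

instance (F : NonnegSymmOp X) : InnerProductSpace ℝ (PreRKHS F) :=
  InnerProductSpace.ofCore (PreRKHS.core F)

theorem PreRKHS.inner_of (F : NonnegSymmOp X) (xs ys : StrongDual ℝ X) :
    inner ℝ (PreRKHS.of F xs) (PreRKHS.of F ys) = ys (F.toCLM xs) := rfl

/-- The reproducing kernel Hilbert space associated with `F`: the completion of `F X*` in the norm
given by `|F xs|² = ⟨F xs, xs⟩`. It is mapped into `X` by `RKHS.incl`. -/
abbrev RKHS (F : NonnegSymmOp X) : Type _ := UniformSpace.Completion (PreRKHS F)

/-- The operator `i* : X* → H`, sending `xs` to the element `F xs` of the reproducing kernel Hilbert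
space. -/
def RKHS.istar (F : NonnegSymmOp X) (xs : StrongDual ℝ X) : RKHS F :=
  ((PreRKHS.of F xs : PreRKHS F) : UniformSpace.Completion (PreRKHS F))

/-- The map `xs ↦ F xs`, continuous for the seminorm `⟨F xs, xs⟩^{1/2}`. -/
def PreRKHS.toX (F : NonnegSymmOp X) : PreRKHS F →L[ℝ] X :=
  LinearMap.mkContinuous (F.toCLM.toLinearMap ∘ₗ (PreRKHS.of F).symm.toLinearMap)
    (Real.sqrt ‖F.toCLM‖) (by
      intro x
      obtain ⟨xs, rfl⟩ := (PreRKHS.of F).surjective x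
      simp only [LinearMap.comp_apply, LinearEquiv.coe_coe, LinearEquiv.symm_apply_apply,
        ContinuousLinearMap.coe_coe]
      refine NormedSpace.norm_le_dual_bound ℝ _ (by positivity) fun ys => ?_
      have h1 := norm_inner_le_norm (𝕜 := ℝ) (PreRKHS.of F xs) (PreRKHS.of F ys)
      rw [PreRKHS.inner_of] at h1
      have h2 : ‖PreRKHS.of F ys‖ ≤ Real.sqrt ‖F.toCLM‖ * ‖ys‖ := by
        rw [← abs_of_nonneg (norm_nonneg (PreRKHS.of F ys))]
        refine abs_le_of_sq_le_sq ?_ (by positivity)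
        rw [mul_pow, Real.sq_sqrt (norm_nonneg F.toCLM), ← real_inner_self_eq_norm_sq,
          PreRKHS.inner_of]
        calc ys (F.toCLM ys) ≤ ‖ys (F.toCLM ys)‖ := le_abs_self _
          _ ≤ ‖ys‖ * (‖F.toCLM‖ * ‖ys‖) :=
            (ys.le_opNorm _).trans (by gcongr; exact F.toCLM.le_opNorm _)
          _ = _ := by ring
      calc ‖ys (F.toCLM xs)‖ ≤ ‖PreRKHS.of F xs‖ * ‖PreRKHS.of F ys‖ := h1
        _ ≤ ‖PreRKHS.of F xs‖ * (Real.sqrt ‖F.toCLM‖ * ‖ys‖) := by gcongr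
        _ = _ := by ring)

/-- The injection `i : H → X`: the continuous extension of the inclusion `F X* ↪ X`. -/
def RKHS.incl [CompleteSpace X] (F : NonnegSymmOp X) : RKHS F →L[ℝ] X :=
  (PreRKHS.toX F).extend (UniformSpace.Completion.toComplL (𝕜 := ℝ) (E := PreRKHS F))

theorem RKHS.incl_istar [CompleteSpace X] (F : NonnegSymmOp X) (xs : StrongDual ℝ X) :
    RKHS.incl F (RKHS.istar F xs) = F.toCLM xs :=
  ContinuousLinearMap.extend_eq _ UniformSpace.Completion.denseRange_coe
    (UniformSpace.Completion.isUniformInducing_coe _) _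

theorem RKHS.inner_istar (F : NonnegSymmOp X) (xs ys : StrongDual ℝ X) :
    inner ℝ (RKHS.istar F xs) (RKHS.istar F ys) = ys (F.toCLM xs) :=
  UniformSpace.Completion.inner_coe _ _

theorem RKHS.istar_add (F : NonnegSymmOp X) (xs ys : StrongDual ℝ X) :
    RKHS.istar F (xs + ys) = RKHS.istar F xs + RKHS.istar F ys := by
  simp [RKHS.istar, UniformSpace.Completion.coe_add]

theorem RKHS.istar_smul (F : NonnegSymmOp X) (c : ℝ) (xs : StrongDual ℝ X) :
    RKHS.istar F (c • xs) = c • RKHS.istar F xs := by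
  simp [RKHS.istar, UniformSpace.Completion.coe_smul]

end RKHS

/-! ### Gaussian measures and covariance operators -/

section Gaussian

variable {X : Type*} [NormedAddCommGroup X] [NormedSpace ℝ X] [MeasurableSpace X]

/-- `μ` is a centred Gaussian measure on `X` with covariance operator `R`. -/
structure IsCentredGaussian (μ : Measure X) (R : StrongDual ℝ X → X) : Prop where
  isGaussian : IsGaussian μ
  centred : ∀ f : StrongDual ℝ X, ∫ x, f x ∂μ = 0
  covariance : ∀ f g : StrongDual ℝ X, g (R f) = ∫ x, f x * g x ∂μ

/-- The operator `Q_t xs = ∫_0^t e^{sA} Q e^{sA*} xs ds`, where `e^{sA} = T s`. -/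
def Qt (Q : NonnegSymmOp X) (T : ℝ≥0 → X →L[ℝ] X) (t : ℝ) (xs : StrongDual ℝ X) : X :=
  ∫ s in (0 : ℝ)..t, T s.toNNReal (Q.toCLM (xs.comp (T s.toNNReal)))

end Gaussian

/-! ### Cylindrical functions and the gradient along `H` -/

section Cylindrical

variable {X : Type*} [NormedAddCommGroup X] [NormedSpace ℝ X]

/-- `C_b^1(ℝⁿ)`: bounded `C¹` functions with bounded derivative. -/
def IsCb1 {n : ℕ} (φ : (Fin n → ℝ) → ℝ) : Prop :=
  ContDiff ℝ 1 φ ∧ (∃ C, ∀ ξ, |φ ξ| ≤ C) ∧ ∃ C, ∀ ξ, ‖fderiv ℝ φ ξ‖ ≤ C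

theorem IsCb1.comp_clm {n m : ℕ} {φ : (Fin n → ℝ) → ℝ} (h : IsCb1 φ)
    (P : (Fin m → ℝ) →L[ℝ] (Fin n → ℝ)) : IsCb1 fun ξ => φ (P ξ) := by
  obtain ⟨h1, ⟨C, hC⟩, D, hD⟩ := h
  refine ⟨h1.comp P.contDiff, ⟨C, fun ξ => hC _⟩, D * ‖P‖, fun ξ => ?_⟩
  have : fderiv ℝ (fun ξ => φ (P ξ)) ξ = (fderiv ℝ φ (P ξ)).comp P :=
    (((h1.differentiable one_ne_zero) (P ξ)).hasFDerivAt.comp ξ P.hasFDerivAt).fderiv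
  rw [this]
  exact (ContinuousLinearMap.opNorm_comp_le _ _).trans (by gcongr; exact hD _)

theorem IsCb1.add {n : ℕ} {φ ψ : (Fin n → ℝ) → ℝ} (h : IsCb1 φ) (k : IsCb1 ψ) :
    IsCb1 fun ξ => φ ξ + ψ ξ := by
  obtain ⟨h1, ⟨C, hC⟩, D, hD⟩ := h
  obtain ⟨k1, ⟨C', hC'⟩, D', hD'⟩ := k
  refine ⟨h1.add k1, ⟨C + C', fun ξ => (abs_add_le _ _).trans (add_le_add (hC ξ) (hC' ξ))⟩,
    D + D', fun ξ => ?_⟩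
  rw [fderiv_fun_add ((h1.differentiable one_ne_zero) ξ) ((k1.differentiable one_ne_zero) ξ)]
  exact (norm_add_le _ _).trans (add_le_add (hD ξ) (hD' ξ))

theorem IsCb1.smul {n : ℕ} {φ : (Fin n → ℝ) → ℝ} (h : IsCb1 φ) (c : ℝ) :
    IsCb1 fun ξ => c * φ ξ := by
  obtain ⟨h1, ⟨C, hC⟩, D, hD⟩ := h
  refine ⟨contDiff_const.mul h1, ⟨|c| * C, fun ξ => ?_⟩, |c| * D, fun ξ => ?_⟩
  · rw [abs_mul]; gcongr; exact hC ξ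
  · rw [fderiv_const_mul ((h1.differentiable one_ne_zero) ξ), norm_smul, Real.norm_eq_abs]
    gcongr; exact hD ξ

/-- `FC_b^1(X)`: the functions `f(x) = φ(⟨x, xs 1⟩, …, ⟨x, xs n⟩)` with `φ ∈ C_b^1(ℝⁿ)` and
`xs 1, …, xs n ∈ X*`. -/
def IsFCb1 (f : X → ℝ) : Prop :=
  ∃ (n : ℕ) (φ : (Fin n → ℝ) → ℝ) (xs : Fin n → StrongDual ℝ X),
    IsCb1 φ ∧ ∀ x, f x = φ fun i => xs i x

theorem IsFCb1.add {f g : X → ℝ} (hf : IsFCb1 f) (hg : IsFCb1 g) :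
    IsFCb1 fun x => f x + g x := by
  obtain ⟨n, φ, xs, hφ, hf⟩ := hf
  obtain ⟨m, ψ, ys, hψ, hg⟩ := hg
  refine ⟨n + m, fun ξ => φ (fun i => ξ (Fin.castAdd m i)) + ψ (fun i => ξ (Fin.natAdd n i)),
    Fin.append xs ys, ?_, fun x => ?_⟩
  · exact (hφ.comp_clm (ContinuousLinearMap.pi fun i => ContinuousLinearMap.proj (Fin.castAdd m i))).add
      (hψ.comp_clm (ContinuousLinearMap.pi fun i => ContinuousLinearMap.proj (Fin.natAdd n i)))
  · simp [hf, hg]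

theorem IsFCb1.smul {f : X → ℝ} (hf : IsFCb1 f) (c : ℝ) : IsFCb1 fun x => c * f x := by
  obtain ⟨n, φ, xs, hφ, hf⟩ := hf
  exact ⟨n, _, xs, hφ.smul c, fun x => by simp [hf]⟩

theorem IsFCb1.zero : IsFCb1 fun _ : X => (0 : ℝ) :=
  ⟨0, fun _ => 0, fun i => i.elim0, ⟨contDiff_const, ⟨0, by simp⟩, 0, by simp⟩, by simp⟩

theorem IsFCb1.differentiable {f : X → ℝ} (hf : IsFCb1 f) : Differentiable ℝ f := by
  obtain ⟨n, φ, xs, hφ, hf⟩ := hf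
  have : f = fun x => φ (ContinuousLinearMap.pi xs x) := by
    funext x; rw [hf]; rfl
  rw [this]
  exact (hφ.1.differentiable one_ne_zero).comp (ContinuousLinearMap.pi xs).differentiable

/-- The gradient `D_H f(x) = i* Df(x)`, with `Df` the Fréchet derivative of `f`. -/
def DH (Q : NonnegSymmOp X) (f : X → ℝ) (x : X) : RKHS Q := RKHS.istar Q (fderiv ℝ f x)

/-- In coordinates, `D_H f(x) = ∑ⱼ ∂ⱼφ(⟨x, xs 1⟩, …, ⟨x, xs n⟩) i* (xs j)`. -/
theorem DH_cylindrical (Q : NonnegSymmOp X) {n : ℕ} {φ : (Fin n → ℝ) → ℝ} (hφ : IsCb1 φ)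
    (xs : Fin n → StrongDual ℝ X) (x : X) :
    DH Q (fun y => φ fun i => xs i y) x =
      ∑ j, fderiv ℝ φ (fun i => xs i x) (Pi.single j 1) • RKHS.istar Q (xs j) := by
  have h : HasFDerivAt (fun y => φ fun i => xs i y)
      ((fderiv ℝ φ fun i => xs i x).comp (ContinuousLinearMap.pi xs)) x :=
    HasFDerivAt.comp (g := φ) (f := ContinuousLinearMap.pi xs) x
      ((hφ.1.differentiable one_ne_zero) _).hasFDerivAt (ContinuousLinearMap.pi xs).hasFDerivAt
  have h2 : (fderiv ℝ φ fun i => xs i x).comp (ContinuousLinearMap.pi xs) =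
      ∑ j, fderiv ℝ φ (fun i => xs i x) (Pi.single j 1) • xs j := by
    ext y
    rw [ContinuousLinearMap.comp_apply]
    conv_lhs => rw [show (ContinuousLinearMap.pi xs y) = ∑ j, xs j y • Pi.single j (1 : ℝ) by
      ext i; simp [Finset.sum_apply, Pi.single_apply]]
    simp [mul_comm]
  rw [DH, h.fderiv, h2]
  have hs : ∀ s : Finset (Fin n), RKHS.istar Q
      (∑ j ∈ s, fderiv ℝ φ (fun i => xs i x) (Pi.single j 1) • xs j) =
      ∑ j ∈ s, fderiv ℝ φ (fun i => xs i x) (Pi.single j 1) • RKHS.istar Q (xs j) := by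
    intro s
    induction s using Finset.cons_induction with
    | empty => simpa using RKHS.istar_smul Q 0 0
    | cons a s ha ih => rw [Finset.sum_cons, Finset.sum_cons, RKHS.istar_add, RKHS.istar_smul, ih]
  exact hs _

end Cylindrical

/-! ### The gradient as an operator on `L^p` and the Sobolev spaces -/

section Sobolev

variable {X : Type*} [NormedAddCommGroup X] [NormedSpace ℝ X] [MeasurableSpace X]

/-- The graph of `D_H : FC_b^1(X) → L^p(X, γ; H)` in `L^p(X, γ) × L^p(X, γ; H)`: the pairs of classes
of `f` and `D_H f`, for `f ∈ FC_b^1(X)`. -/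
def cylGraph (Q : NonnegSymmOp X) (γ : Measure X) (p : ℝ≥0∞) [Fact (1 ≤ p)] :
    Submodule ℝ (Lp ℝ p γ × Lp (RKHS Q) p γ) where
  carrier := {w | ∃ f : X → ℝ, IsFCb1 f ∧ w.1 =ᵐ[γ] f ∧ w.2 =ᵐ[γ] DH Q f}
  zero_mem' := by
    refine ⟨fun _ => 0, IsFCb1.zero, Lp.coeFn_zero _ _ _, ?_⟩
    refine (Lp.coeFn_zero _ _ _).trans (Eventually.of_forall fun x => ?_)
    simpa [DH] using (RKHS.istar_smul Q 0 0).symm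
  add_mem' := by
    rintro v w ⟨f, hf, hf1, hf2⟩ ⟨g, hg, hg1, hg2⟩
    refine ⟨_, hf.add hg, ?_, ?_⟩
    · filter_upwards [Lp.coeFn_add v.1 w.1, hf1, hg1] with x h1 h2 h3
      rw [Prod.fst_add, h1, Pi.add_apply, h2, h3]
    · filter_upwards [Lp.coeFn_add v.2 w.2, hf2, hg2] with x h1 h2 h3
      rw [Prod.snd_add, h1, Pi.add_apply, h2, h3, DH, DH, DH,
        fderiv_fun_add (hf.differentiable x) (hg.differentiable x), RKHS.istar_add]
  smul_mem' := by
    rintro c w ⟨f, hf, hf1, hf2⟩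
    refine ⟨_, hf.smul c, ?_, ?_⟩
    · filter_upwards [Lp.coeFn_smul c w.1, hf1] with x h1 h2
      rw [Prod.smul_fst, h1, Pi.smul_apply, h2, smul_eq_mul]
    · filter_upwards [Lp.coeFn_smul c w.2, hf2] with x h1 h2
      rw [Prod.smul_snd, h1, Pi.smul_apply, h2, DH, DH,
        fderiv_const_mul (hf.differentiable x), RKHS.istar_smul]

/-- The operator `D_H`, with domain the classes of functions in `FC_b^1(X)`, from `L^p(X, γ)` to
`L^p(X, γ; H)`. Its graph is `cylGraph Q γ p` whenever that set is the graph of a map. -/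
def DHLp (Q : NonnegSymmOp X) (γ : Measure X) (p : ℝ≥0∞) [Fact (1 ≤ p)] :
    Lp ℝ p γ →ₗ.[ℝ] Lp (RKHS Q) p γ :=
  (cylGraph Q γ p).toLinearPMap

/-- `f ∈ W_H^{1,p}(X, γ)`, for a function `f` on `X`: the class of `f` lies in the projection to
`L^p(X, γ)` of the closure of the graph of `D_H`. -/
def MemSobolev (Q : NonnegSymmOp X) (γ : Measure X) (p : ℝ≥0∞) [Fact (1 ≤ p)] (f : X → ℝ) : Prop :=
  ∃ (hf : MemLp f p γ) (G : Lp (RKHS Q) p γ), (hf.toLp f, G) ∈ (cylGraph Q γ p).topologicalClosure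

/-- The space `W_H^{1,p}(X, γ)`, the domain of the closure of `D_H` in `L^p(X, γ)`. -/
def W1p (Q : NonnegSymmOp X) (γ : Measure X) (p : ℝ≥0∞) [Fact (1 ≤ p)] : Type _ :=
  (DHLp Q γ p).closure.domain

variable (Q : NonnegSymmOp X) (γ : Measure X) (p : ℝ≥0∞) [Fact (1 ≤ p)]

instance : AddCommGroup (W1p Q γ p) := inferInstanceAs (AddCommGroup (DHLp Q γ p).closure.domain)

instance : Module ℝ (W1p Q γ p) := inferInstanceAs (Module ℝ (DHLp Q γ p).closure.domain)

variable {Q γ p} in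
/-- The class in `L^p(X, γ)` of an element of `W_H^{1,p}(X, γ)`. -/
def W1p.toLp : W1p Q γ p →ₗ[ℝ] Lp ℝ p γ := (DHLp Q γ p).closure.domain.subtype

variable {Q γ p} in
/-- The closure of `D_H`, on `W_H^{1,p}(X, γ)`. -/
def W1p.grad : W1p Q γ p →ₗ[ℝ] Lp (RKHS Q) p γ := (DHLp Q γ p).closure.toFun

/-- The norm `‖f‖_{1,p,H} = ‖f‖_{L^p(X, γ)} + ‖D_H f‖_{L^p(X, γ; H)}`. -/
instance : NormedAddCommGroup (W1p Q γ p) :=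
  AddGroupNorm.toNormedAddCommGroup
    { toFun := fun f => ‖f.toLp‖ + ‖f.grad‖
      map_zero' := by simp
      add_le' := fun f g => by
        rw [map_add, map_add]
        linarith [norm_add_le f.toLp g.toLp, norm_add_le f.grad g.grad]
      neg' := fun f => by simp
      eq_zero_of_map_eq_zero' := fun f hf => by
        have h : ‖f.toLp‖ = 0 := by linarith [norm_nonneg f.toLp, norm_nonneg f.grad]
        exact Subtype.ext (norm_eq_zero.1 h) }

theorem W1p.norm_def (f : W1p Q γ p) : ‖f‖ = ‖f.toLp‖ + ‖f.grad‖ := rfl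

instance : NormedSpace ℝ (W1p Q γ p) where
  norm_smul_le c f := by
    simp only [W1p.norm_def, map_smul, norm_smul, mul_add, le_refl]

/-- The space `W_H^{1,2}(X, γ)`, to be endowed with its inner product instead of the norm
`‖·‖_{1,2,H}`. -/
def W12 : Type _ := W1p Q γ 2

instance : AddCommGroup (W12 Q γ) := inferInstanceAs (AddCommGroup (W1p Q γ 2))

instance : Module ℝ (W12 Q γ) := inferInstanceAs (Module ℝ (W1p Q γ 2))

variable {Q γ} in
def W12.toW1p : W12 Q γ ≃ₗ[ℝ] W1p Q γ 2 := LinearEquiv.refl ℝ _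

theorem W12.integral_mul (u v : W12 Q γ) : (∫ x, u.toW1p.toLp x * v.toW1p.toLp x ∂γ) =
    inner ℝ u.toW1p.toLp v.toW1p.toLp := by
  rw [L2.inner_def]
  simp [mul_comm]

/-- The inner product `⟨f, g⟩ = ∫ f g dγ + ∫ [D_H f, D_H g]_H dγ`. -/
@[reducible] def W12.core : InnerProductSpace.Core ℝ (W12 Q γ) where
  inner f g := (∫ x, f.toW1p.toLp x * g.toW1p.toLp x ∂γ) +
    ∫ x, inner ℝ (f.toW1p.grad x) (g.toW1p.grad x) ∂γ
  conj_inner_symm f g := by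
    simp only [mul_comm, real_inner_comm, conj_trivial]
  re_inner_nonneg f := by
    simp only [RCLike.re_to_real]
    exact add_nonneg (integral_nonneg fun x => mul_self_nonneg _)
      (integral_nonneg fun x => real_inner_self_nonneg)
  add_left f g h := by
    simp only [W12.integral_mul, ← L2.inner_def]
    simp only [map_add, inner_add_left]
    ring
  smul_left f g r := by
    simp only [W12.integral_mul, ← L2.inner_def]
    simp only [map_smul, inner_smul_left, mul_add]
  definite f hf := by
    simp only [W12.integral_mul, ← L2.inner_def] at hf
    have h1 : 0 ≤ inner ℝ f.toW1p.toLp f.toW1p.toLp := real_inner_self_nonneg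
    have h2 : 0 ≤ inner ℝ f.toW1p.grad f.toW1p.grad := real_inner_self_nonneg
    have h3 : inner ℝ f.toW1p.toLp f.toW1p.toLp = 0 := by linarith
    exact Subtype.ext (inner_self_eq_zero.1 h3)

instance : NormedAddCommGroup (W12 Q γ) :=
  @InnerProductSpace.Core.toNormedAddCommGroup ℝ _ _ _ _ (W12.core Q γ)

instance : InnerProductSpace ℝ (W12 Q γ) := InnerProductSpace.ofCore (W12.core Q γ).toCore

theorem W12.inner_def (f g : W12 Q γ) :
    inner ℝ f g = (∫ x, f.toW1p.toLp x * g.toW1p.toLp x ∂γ) +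
      ∫ x, inner ℝ (f.toW1p.grad x) (g.toW1p.grad x) ∂γ := rfl

end Sobolev

/-! ### The standing assumptions -/

section Assumptions

variable {X : Type*} [NormedAddCommGroup X] [NormedSpace ℝ X] [MeasurableSpace X]

/-- The assumptions on `(Q_t)`: for `t > 0`, `Q_t` is the covariance operator of a centred Gaussian
measure; `Q_t xs → Q_∞ xs` weakly as `t → ∞`, for each `xs`; and `Q_∞` is the covariance operator of
the centred nondegenerate Gaussian measure `μ`. -/
structure CovarianceAssumption (Q Qinf : NonnegSymmOp X) (T : ℝ≥0 → X →L[ℝ] X) (μ : Measure X) :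
    Prop where
  gaussian_t : ∀ t : ℝ, 0 < t → ∃ μt : Measure X, IsCentredGaussian μt (Qt Q T t)
  weak_limit : ∀ xs ys : StrongDual ℝ X,
    Tendsto (fun t : ℝ => ys (Qt Q T t xs)) atTop (𝓝 (ys (Qinf.toCLM xs)))
  gaussian : IsCentredGaussian μ Qinf.toCLM
  nondegenerate : ∀ xs : StrongDual ℝ X, xs ≠ 0 → 0 < xs (Qinf.toCLM xs)

/-- For each `xs ∈ D(A*)` one has `i_∞* A* xs ∈ H` (both `H_∞` and `H` being regarded as subspaces of
`X`), and `|i_∞* A* xs|_H ≤ c |i* xs|_H` with `c > 0` independent of `xs`. -/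
def AnalyticityAssumption [CompleteSpace X] (Q Qinf : NonnegSymmOp X) (A : X →ₗ.[ℝ] X) : Prop :=
  ∃ c : ℝ, 0 < c ∧ ∀ xs ys : StrongDual ℝ X, IsAdjointAt A xs ys →
    ∃ h : RKHS Q, RKHS.incl Q h = RKHS.incl Qinf (RKHS.istar Qinf ys) ∧
      ‖h‖ ≤ c * ‖RKHS.istar Q xs‖

/-- `U : X → (-∞, +∞]` is proper, lower semicontinuous and convex (its epigraph is convex), and
belongs to `W_H^{1,p}(X, μ)` for all `p ∈ [1, ∞)`; in particular it is finite `μ`-a.e. -/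
structure WeightAssumption (Q : NonnegSymmOp X) (μ : Measure X) (U : X → EReal) : Prop where
  ne_bot : ∀ x, U x ≠ ⊥
  proper : ∃ x, U x ≠ ⊤
  lsc : LowerSemicontinuous U
  convex : Convex ℝ {q : X × ℝ | U q.1 ≤ q.2}
  ae_finite : ∀ᵐ x ∂μ, U x ≠ ⊤
  sobolev : ∀ (p : ℝ≥0∞) [Fact (1 ≤ p)], p ≠ ∞ → MemSobolev Q μ p fun x => (U x).toReal

/-- The weighted measure `ν_∞ = e^{-U} μ_∞`. -/
def weightedMeasure (μ : Measure X) (U : X → EReal) : Measure X :=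
  μ.withDensity fun x => (-U x).exp

end Assumptions

end WeightedOU

end

/-!
The closability of `D_H` in `L^p(ν_∞)`, `ν_∞ = e^{-U} μ_∞`, follows from integration by parts along
sufficiently many directions of `H`.

*Directions.* A centred Gaussian measure can be differentiated along every vector in the range of its
covariance operator (`IsCentredGaussian.integral_fderiv`). The relevant elements of `H` are therefore
those whose image in `X` lies in the range of `Q_∞` (`rangeDirections`). The analyticity assumption
supplies such elements: for `xs ∈ D(A*)` the vector `Q_∞ A* xs` comes from an `h ∈ H` with
`|h|_H ≤ c |i* xs|_H`. They are dense in `H` (`dense_rangeDirections`). Indeed, the Lyapunov equation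
`2 ⟨Q_∞ A* xs, xs⟩ = -⟨Q xs, xs⟩` (`IsAdjointAt.lyapunov`) says that `2 [h, i* xs]_H = -|i* xs|_H²`;
if `v ⊥ h` for all these `h`, letting `i* xs → v` gives `v = 0`. Such an approximation of `v` exists
because `D(A*)` separates the points of `X` (`dense_istarAdjointDomain`).

*The weight.* As `U ∈ W_H^{1,q}(μ_∞)` for the exponent `q` conjugate to `p`, the product rule and an
approximation of `U` by cylindrical functions extend the integration by parts to weights `χ(U)`, for
bounded `C¹` functions `χ` with bounded derivative (`exists_gradient_integral_DH`). With
`χ(t) = ψ(t) e^{-t}` and `ψ` of compact support this becomes, for cylindrical `f` and `g`, an identity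
`∫ [D_H f, h]_H g ψ(U) dν_∞ = ∫ f R dν_∞` with `R ∈ L^q(ν_∞)` (`WeightAssumption.exists_adjoint`),
which extends to the closure of the graph of `D_H`. If `(0, G)` lies in that closure, then
`∫ [G, h]_H g ψ(U) dν_∞ = 0` for all `g`, `ψ` and `h`, and so `G = 0`: cylindrical functions separate
integrable functions (by uniqueness of characteristic functionals), `U` is finite almost everywhere,
and the directions `h` are dense.

Convexity and lower semicontinuity of `U` provide an affine minorant, whence `ν_∞` is finite by the
exponential integrability of Gaussian variables (`isFiniteMeasure_weightedMeasure`). Completeness of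
the Sobolev spaces is that of the graph of a closed operator.
-/

noncomputable section

namespace WeightedOU

/-! ### Orbit integrals, the adjoint generator and the Lyapunov equation -/

section Semigroup

variable {X : Type*} [NormedAddCommGroup X] [NormedSpace ℝ X]
variable {T : ℝ≥0 → X →L[ℝ] X} {A : X →ₗ.[ℝ] X}

theorem IsContractionSemigroup.norm_apply_le (hT : IsContractionSemigroup T) (t : ℝ≥0) (x : X) :
    ‖T t x‖ ≤ ‖x‖ :=
  ((T t).le_of_opNorm_le (hT.norm_le_one t) x).trans_eq (one_mul _)

theorem IsContractionSemigroup.continuous_orbit (hT : IsContractionSemigroup T) (x : X) :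
    Continuous fun s : ℝ => T s.toNNReal x :=
  (hT.strongly_continuous x).comp continuous_real_toNNReal

/-- By contractivity, strong continuity persists when the vector varies continuously. -/
theorem IsContractionSemigroup.continuous_apply (hT : IsContractionSemigroup T) {c : ℝ → X}
    (hc : Continuous c) : Continuous fun s : ℝ => T s.toNNReal (c s) := by
  refine continuous_iff_continuousAt.2 fun s₀ => ?_
  have h1 : Tendsto (fun s => T s.toNNReal (c s₀)) (𝓝 s₀) (𝓝 (T s₀.toNNReal (c s₀))) :=
    (hT.continuous_orbit (c s₀)).continuousAt
  have h2 : Tendsto (fun s => T s.toNNReal (c s - c s₀)) (𝓝 s₀) (𝓝 0) := by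
    refine squeeze_zero_norm (fun s => hT.norm_apply_le _ _) ?_
    have := ((hc.sub continuous_const).norm (E := X)).tendsto (f := fun s => ‖c s - c s₀‖) s₀
    simpa using this
  have h3 := h2.add h1
  simp only [map_sub, sub_add_cancel, zero_add] at h3
  exact h3

/-- The operator `x ↦ ∫_0^t T s x ds`. -/
def orbitIntegral (hT : IsContractionSemigroup T) (t : ℝ) : X →L[ℝ] X :=
  LinearMap.mkContinuous
    { toFun := fun x => ∫ s in (0 : ℝ)..t, T s.toNNReal x
      map_add' := fun x y => by
        simp only [map_add]
        exact intervalIntegral.integral_add ((hT.continuous_orbit x).intervalIntegrable _ _)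
          ((hT.continuous_orbit y).intervalIntegrable _ _)
      map_smul' := fun c x => by
        simp only [map_smul, RingHom.id_apply]
        exact intervalIntegral.integral_smul _ _ }
    |t| (fun x => by
      have := intervalIntegral.norm_integral_le_of_norm_le_const (a := 0) (b := t) (C := ‖x‖)
        (f := fun s => T s.toNNReal x) (fun s _ => hT.norm_apply_le _ _)
      simpa [mul_comm] using this)

theorem orbitIntegral_apply (hT : IsContractionSemigroup T) (t : ℝ) (x : X) :
    orbitIntegral hT t x = ∫ s in (0 : ℝ)..t, T s.toNNReal x := rfl

theorem norm_orbitIntegral_le (hT : IsContractionSemigroup T) (t : ℝ) :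
    ‖orbitIntegral hT t‖ ≤ |t| :=
  LinearMap.mkContinuous_norm_le _ (abs_nonneg t) _

theorem orbitIntegral_zero (hT : IsContractionSemigroup T) : orbitIntegral hT 0 = 0 := by
  ext x; simp [orbitIntegral_apply]

theorem tendsto_coe_nhdsGT_zero : Tendsto ((↑) : ℝ≥0 → ℝ) (𝓝[>] 0) (𝓝[≠] 0) := by
  refine tendsto_nhdsWithin_iff.2 ⟨?_, ?_⟩
  · exact (NNReal.continuous_coe.tendsto' 0 0 rfl).mono_left nhdsWithin_le_nhds
  · filter_upwards [self_mem_nhdsWithin] with t ht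
    simpa using (ne_of_gt ht)

variable [CompleteSpace X]

theorem hasDerivAt_orbitIntegral (hT : IsContractionSemigroup T) (x : X) (t : ℝ) :
    HasDerivAt (fun t => orbitIntegral hT t x) (T t.toNNReal x) t :=
  intervalIntegral.integral_hasDerivAt_right ((hT.continuous_orbit x).intervalIntegrable _ _)
    ((hT.continuous_orbit x).stronglyMeasurableAtFilter _ _) (hT.continuous_orbit x).continuousAt

theorem tendsto_slope_orbitIntegral (hT : IsContractionSemigroup T) (x : X) (t : ℝ≥0) :
    Tendsto (fun h : ℝ≥0 => (h : ℝ)⁻¹ • (orbitIntegral hT (t + h) x - orbitIntegral hT t x))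
      (𝓝[>] 0) (𝓝 (T t x)) := by
  have := (hasDerivAt_iff_tendsto_slope_zero.1 (hasDerivAt_orbitIntegral hT x t)).comp
    tendsto_coe_nhdsGT_zero
  simpa [Function.comp_def] using this

theorem apply_orbitIntegral (hT : IsContractionSemigroup T) (x : X) (t h : ℝ≥0) :
    T h (orbitIntegral hT t x) = orbitIntegral hT (t + h) x - orbitIntegral hT h x := by
  have hI : ∀ a b : ℝ, IntervalIntegrable (fun s : ℝ => T s.toNNReal x) volume a b :=
    fun a b => (hT.continuous_orbit x).intervalIntegrable _ _
  simp only [orbitIntegral_apply]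
  rw [← ContinuousLinearMap.intervalIntegral_comp_comm _ (hI _ _),
    intervalIntegral.integral_interval_sub_left (hI _ _) (hI _ _)]
  have h1 : ∀ s ∈ Set.uIcc (0 : ℝ) t, T h (T s.toNNReal x) = T (s + h).toNNReal x := by
    intro s hs
    rw [Set.uIcc_of_le t.coe_nonneg] at hs
    rw [Real.toNNReal_add hs.1 h.coe_nonneg, Real.toNNReal_coe, add_comm, hT.map_add]
    rfl
  rw [intervalIntegral.integral_congr h1,
    intervalIntegral.integral_comp_add_right (fun s => T s.toNNReal x), zero_add]

theorem tendsto_generator_orbitIntegral (hT : IsContractionSemigroup T) (x : X) (t : ℝ≥0) :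
    Tendsto (fun h : ℝ≥0 => (h : ℝ)⁻¹ • (T h (orbitIntegral hT t x) - orbitIntegral hT t x))
      (𝓝[>] 0) (𝓝 (T t x - x)) := by
  have h1 := tendsto_slope_orbitIntegral hT x t
  have h2 := tendsto_slope_orbitIntegral hT x 0
  rw [hT.map_zero] at h2
  refine (h1.sub h2).congr fun h => ?_
  rw [apply_orbitIntegral, ← smul_sub]
  simp [orbitIntegral_zero, sub_right_comm]

theorem orbitIntegral_mem_graph (hT : IsContractionSemigroup T) (hA : IsGenerator A T) (x : X)
    (t : ℝ≥0) : (orbitIntegral hT t x, T t x - x) ∈ A.graph :=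
  (hA _ _).2 (tendsto_generator_orbitIntegral hT x t)

theorem orbitIntegral_generator (hT : IsContractionSemigroup T) (hA : IsGenerator A T)
    (x : A.domain) (t : ℝ≥0) : orbitIntegral hT t (A x) = T t x - x := by
  have h1 := (hA _ _).1 (A.mem_graph x)
  have h2 := ((orbitIntegral hT t).continuous.tendsto _).comp h1
  refine tendsto_nhds_unique h2 ((tendsto_generator_orbitIntegral hT (x : X) t).congr fun h => ?_)
  -- the orbit integral commutes with the semigroup
  have hcomm : orbitIntegral hT t (T h x) = T h (orbitIntegral hT t x) := by
    rw [orbitIntegral_apply, orbitIntegral_apply, ← ContinuousLinearMap.intervalIntegral_comp_comm _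
      ((hT.continuous_orbit _).intervalIntegrable _ _)]
    refine intervalIntegral.integral_congr fun s _ => ?_
    change (T s.toNNReal).comp (T h) x = (T h).comp (T s.toNNReal) x
    rw [← hT.map_add, ← hT.map_add, add_comm]
  simp [hcomm]

/-- On the domain of the adjoint, `T t* xs - xs = ∫_0^t T s* A* xs ds` in the weak* sense. -/
theorem IsAdjointAt.apply_sub (hT : IsContractionSemigroup T) (hA : IsGenerator A T)
    {xs ys : StrongDual ℝ X} (h : IsAdjointAt A xs ys) (t : ℝ≥0) (x : X) :
    xs (T t x) - xs x = ys (orbitIntegral hT t x) := by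
  obtain ⟨y, hy1, hy2⟩ := (LinearPMap.mem_graph_iff A).1 (orbitIntegral_mem_graph hT hA x t)
  rw [← map_sub]
  simp only at hy1 hy2
  rw [← hy2, h y, hy1]

theorem isAdjointAt_comp_orbitIntegral (hT : IsContractionSemigroup T) (hA : IsGenerator A T)
    (xs : StrongDual ℝ X) (t : ℝ≥0) :
    IsAdjointAt A (xs.comp (orbitIntegral hT t)) (xs.comp (T t) - xs) := fun x => by
  simp [orbitIntegral_generator hT hA x t]

/-- The domain of the adjoint of the generator is weak* dense: it separates the points of `X`. -/
theorem eq_zero_of_forall_isAdjointAt (hT : IsContractionSemigroup T) (hA : IsGenerator A T) {x : X}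
    (hx : ∀ xs ys : StrongDual ℝ X, IsAdjointAt A xs ys → xs x = 0) : x = 0 := by
  have h0 : ∀ t : ℝ≥0, orbitIntegral hT t x = 0 := fun t =>
    SeparatingDual.eq_zero_of_forall_dual_eq_zero (R := ℝ) fun xs =>
      hx _ _ (isAdjointAt_comp_orbitIntegral hT hA xs t)
  have h1 := tendsto_slope_orbitIntegral hT x 0
  have h2 : ∀ h : ℝ≥0, orbitIntegral hT (0 + h) x = 0 := fun h => by rw [zero_add]; exact h0 h
  simp only [NNReal.coe_zero, h2, orbitIntegral_zero, _root_.zero_apply, sub_zero,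
    smul_zero, hT.map_zero, ContinuousLinearMap.id_apply] at h1
  exact (tendsto_nhds_unique h1 tendsto_const_nhds)

theorem IsAdjointAt.continuous_comp (hT : IsContractionSemigroup T) (hA : IsGenerator A T)
    {xs ys : StrongDual ℝ X} (h : IsAdjointAt A xs ys) :
    Continuous fun s : ℝ => xs.comp (T s.toNNReal) := by
  suffices H : LipschitzWith ‖ys‖₊ fun t : ℝ≥0 => xs.comp (T t) from
    H.continuous.comp continuous_real_toNNReal
  refine LipschitzWith.of_dist_le_mul fun t s => ?_
  rw [dist_eq_norm]
  refine ContinuousLinearMap.opNorm_le_bound _ (by positivity) fun x => ?_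
  have h1 : (xs.comp (T t) - xs.comp (T s)) x =
      ys (∫ r in (s : ℝ)..t, T r.toNNReal x) := by
    have h2 := h.apply_sub hT hA t x
    have h3 := h.apply_sub hT hA s x
    rw [← intervalIntegral.integral_interval_sub_left (a := 0)
      ((hT.continuous_orbit x).intervalIntegrable _ _)
      ((hT.continuous_orbit x).intervalIntegrable _ _), map_sub, ← orbitIntegral_apply hT,
      ← orbitIntegral_apply hT, ← h2, ← h3]
    simp
  rw [h1]
  have h4 := intervalIntegral.norm_integral_le_of_norm_le_const (a := s) (b := t) (C := ‖x‖)
        (f := fun s => T s.toNNReal x) (fun s _ => hT.norm_apply_le _ _)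
  calc _ ≤ ‖ys‖ * (‖x‖ * |(t : ℝ) - s|) := (ys.le_opNorm _).trans (by gcongr)
    _ = _ := by rw [coe_nnnorm, NNReal.dist_eq]; ring

/-- The Lyapunov equation `Q_∞ A* + A Q_∞ = -Q`, in quadratic form on the domain of `A*`: it is the
derivative at `h = 0` of the identity `⟨Q_∞ T_h* xs, T_h* xs⟩ = ⟨Q_∞ xs, xs⟩ - ⟨Q_h xs, xs⟩`. -/
theorem IsAdjointAt.lyapunov (hT : IsContractionSemigroup T) (hA : IsGenerator A T)
    {Q Qinf : NonnegSymmOp X}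
    (hlim : ∀ xs ys : StrongDual ℝ X,
      Tendsto (fun t : ℝ => ys (Qt Q T t xs)) atTop (𝓝 (ys (Qinf.toCLM xs))))
    {xs ys : StrongDual ℝ X} (h : IsAdjointAt A xs ys) :
    2 * ys (Qinf.toCLM xs) = - xs (Q.toCLM xs) := by
  set I : ℝ → X := fun s => T s.toNNReal (Q.toCLM (xs.comp (T s.toNNReal))) with hI
  have hIc : Continuous I := hT.continuous_apply (Q.toCLM.continuous.comp (h.continuous_comp hT hA))
  set b : ℝ → ℝ := fun s => xs (I s) with hb
  have hbc : Continuous b := xs.continuous.comp hIc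
  have hbI : ∀ r s : ℝ, IntervalIntegrable b volume r s := fun r s => hbc.intervalIntegrable _ _
  have hxs : ∀ t : ℝ, xs (Qt Q T t xs) = ∫ s in (0 : ℝ)..t, b s := fun t =>
    (ContinuousLinearMap.intervalIntegral_comp_comm xs (hIc.intervalIntegrable _ _)).symm
  -- `⟨Q_∞ T_r* xs, T_r* xs⟩ = ⟨Q_∞ xs, xs⟩ - ⟨Q_r xs, xs⟩`, by letting `t → ∞` in the identity for `Q_t`
  have hzs : ∀ r : ℝ≥0, (xs.comp (T r)) (Qinf.toCLM (xs.comp (T r))) =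
      xs (Qinf.toCLM xs) - ∫ s in (0 : ℝ)..r, b s := by
    intro r
    have h1 : ∀ t : ℝ, 0 ≤ t → (xs.comp (T r)) (Qt Q T t (xs.comp (T r))) =
        (∫ s in (0 : ℝ)..(t + r), b s) - ∫ s in (0 : ℝ)..r, b s := by
      intro t ht
      have hshift : ∀ s : ℝ, 0 ≤ s → (xs.comp (T r)).comp (T s.toNNReal) =
          xs.comp (T (s + r).toNNReal) := by
        intro s hs
        rw [Real.toNNReal_add hs r.coe_nonneg, Real.toNNReal_coe, add_comm, hT.map_add]
        rfl
      have hsum : ∀ s ∈ Set.uIcc 0 t, (xs.comp (T r)) (T s.toNNReal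
          (Q.toCLM ((xs.comp (T r)).comp (T s.toNNReal)))) = b (s + r) := by
        intro s hs
        rw [Set.uIcc_of_le ht] at hs
        rw [hshift s hs.1, ← ContinuousLinearMap.comp_apply, hshift s hs.1]
        rfl
      have hint : ∀ s ∈ Set.uIcc 0 t, T s.toNNReal
          (Q.toCLM ((xs.comp (T r)).comp (T s.toNNReal))) =
          T s.toNNReal (Q.toCLM (xs.comp (T (s + r).toNNReal))) := by
        intro s hs
        rw [Set.uIcc_of_le ht] at hs
        rw [hshift s hs.1]
      have hc : Continuous fun s : ℝ =>
          T s.toNNReal (Q.toCLM (xs.comp (T (s + r).toNNReal))) :=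
        hT.continuous_apply (Q.toCLM.continuous.comp
          ((h.continuous_comp hT hA).comp (continuous_id.add continuous_const)))
      rw [intervalIntegral.integral_interval_sub_left (hbI _ _) (hbI _ _), Qt,
        ← ContinuousLinearMap.intervalIntegral_comp_comm, intervalIntegral.integral_congr hsum,
        intervalIntegral.integral_comp_add_right b, zero_add]
      exact (hc.intervalIntegrable _ _).congr (fun s hs => (hint s (Set.uIoc_subset_uIcc hs)).symm)
    have h2 : Tendsto (fun t : ℝ => (∫ s in (0 : ℝ)..(t + r), b s) - ∫ s in (0 : ℝ)..r, b s) atTop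
        (𝓝 (xs (Qinf.toCLM xs) - ∫ s in (0 : ℝ)..r, b s)) := by
      have := (hlim xs xs).comp (tendsto_atTop_add_const_right atTop (r : ℝ) tendsto_id)
      simp only [Function.comp_def, hxs, id] at this
      exact this.sub_const _
    refine tendsto_nhds_unique (hlim _ _) (h2.congr' ?_)
    filter_upwards [eventually_ge_atTop 0] with t ht using (h1 t ht).symm
  -- difference quotients of both sides of `hzs`
  have hB : Tendsto (fun r : ℝ≥0 => (r : ℝ)⁻¹ * ∫ s in (0 : ℝ)..r, b s) (𝓝[>] 0)
      (𝓝 (xs (Q.toCLM xs))) := by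
    have hd : HasDerivAt (fun r => ∫ s in (0 : ℝ)..r, b s) (b 0) 0 :=
      intervalIntegral.integral_hasDerivAt_right (hbI _ _) (hbc.stronglyMeasurableAtFilter _ _)
        hbc.continuousAt
    have := (hasDerivAt_iff_tendsto_slope_zero.1 hd).comp tendsto_coe_nhdsGT_zero
    have hb0 : b 0 = xs (Q.toCLM xs) := by
      simp [hb, hI, hT.map_zero]
    simpa [Function.comp_def, hb0] using this
  have hkey : ∀ r : ℝ≥0, (r : ℝ)⁻¹ * ∫ s in (0 : ℝ)..r, b s =
      - ys ((r : ℝ)⁻¹ • orbitIntegral hT r (Qinf.toCLM (xs.comp (T r)) + Qinf.toCLM xs)) := by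
    intro r
    have h1 := hzs r
    have h2 := h.apply_sub hT hA r (Qinf.toCLM (xs.comp (T r)) + Qinf.toCLM xs)
    have h3 := Qinf.symm xs (xs.comp (T r))
    simp only [map_add, ContinuousLinearMap.comp_apply] at h1 h2 h3
    rw [map_smul, map_add, map_add, ← h2, smul_eq_mul]
    rw [show ∫ s in (0 : ℝ)..r, b s = xs (Qinf.toCLM xs) - xs (T r (Qinf.toCLM (xs.comp (T r)))) by
      linarith, h3]
    ring
  have hw : Tendsto (fun r : ℝ≥0 => Qinf.toCLM (xs.comp (T r)) + Qinf.toCLM xs) (𝓝[>] 0)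
      (𝓝 (Qinf.toCLM xs + Qinf.toCLM xs)) := by
    refine Tendsto.add_const _ ?_
    have h1 := ((Qinf.toCLM.continuous.comp (h.continuous_comp hT hA)).tendsto 0).comp
      (tendsto_coe_nhdsGT_zero.mono_right nhdsWithin_le_nhds)
    simpa [Function.comp_def, hT.map_zero] using h1
  have hs := tendsto_slope_orbitIntegral hT (Qinf.toCLM xs + Qinf.toCLM xs) 0
  have herr : Tendsto (fun r : ℝ≥0 => (r : ℝ)⁻¹ • orbitIntegral hT r
      ((Qinf.toCLM (xs.comp (T r)) + Qinf.toCLM xs) - (Qinf.toCLM xs + Qinf.toCLM xs)))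
      (𝓝[>] 0) (𝓝 0) := by
    have hw0 := (tendsto_sub_nhds_zero_iff.2 hw).norm
    rw [norm_zero] at hw0
    refine squeeze_zero_norm' ?_ hw0
    filter_upwards [self_mem_nhdsWithin] with r hr
    have hr' : (0 : ℝ) < r := hr
    rw [norm_smul, norm_inv, Real.norm_of_nonneg hr'.le, inv_mul_le_iff₀ hr']
    exact (orbitIntegral hT r).le_of_opNorm_le
      ((norm_orbitIntegral_le hT r).trans_eq (abs_of_pos hr')) _
  have hfin := (ys.continuous.tendsto _).comp (herr.add hs)
  simp only [hT.map_zero, NNReal.coe_zero, zero_add, orbitIntegral_zero,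
    _root_.zero_apply, sub_zero, ← smul_add, ← map_add, sub_add_cancel,
    Function.comp_def, ContinuousLinearMap.id_apply] at hfin
  have := tendsto_nhds_unique hB ((hfin.neg).congr fun r => by rw [hkey r, map_add])
  rw [map_add, map_add] at this
  linarith

end Semigroup

/-! ### Directions of differentiability in the reproducing kernel Hilbert space -/

section Directions

variable {X : Type*} [NormedAddCommGroup X] [NormedSpace ℝ X]

theorem RKHS.norm_sq_istar (F : NonnegSymmOp X) (xs : StrongDual ℝ X) :
    ‖RKHS.istar F xs‖ ^ 2 = xs (F.toCLM xs) := by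
  rw [← RKHS.inner_istar, real_inner_self_eq_norm_sq]

/-- The operator `i* : X* → H` as a bounded operator. -/
def RKHS.istarCLM (F : NonnegSymmOp X) : StrongDual ℝ X →L[ℝ] RKHS F :=
  LinearMap.mkContinuous
    { toFun := RKHS.istar F, map_add' := RKHS.istar_add F, map_smul' := RKHS.istar_smul F }
    (Real.sqrt ‖F.toCLM‖) (fun xs => by
      refine abs_le_of_sq_le_sq' ?_ (by positivity) |>.2
      change ‖RKHS.istar F xs‖ ^ 2 ≤ _
      rw [RKHS.norm_sq_istar, mul_pow, Real.sq_sqrt (norm_nonneg F.toCLM)]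
      calc xs (F.toCLM xs) ≤ ‖xs (F.toCLM xs)‖ := le_abs_self _
        _ ≤ ‖xs‖ * (‖F.toCLM‖ * ‖xs‖) :=
          (xs.le_opNorm _).trans (by gcongr; exact F.toCLM.le_opNorm _)
        _ = _ := by ring)

variable [CompleteSpace X]

/-- The reproducing property: `i*` is the adjoint of the injection `i : H → X`. -/
theorem RKHS.inner_istar_left (F : NonnegSymmOp X) (xs : StrongDual ℝ X) (h : RKHS F) :
    inner ℝ (RKHS.istar F xs) h = xs (RKHS.incl F h) := by
  induction h using UniformSpace.Completion.induction_on with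
  | hp => exact isClosed_eq (by fun_prop) (by fun_prop)
  | ih a =>
    obtain ⟨ys, rfl⟩ := (PreRKHS.of F).surjective a
    have h1 := RKHS.inner_istar F xs ys
    have h2 := RKHS.incl_istar F ys
    rw [RKHS.istar] at h1 h2
    rw [RKHS.istar, h2, ← F.symm, ← h1]
    rfl

theorem RKHS.eq_zero_of_incl_eq_zero {F : NonnegSymmOp X} {h : RKHS F} (hh : RKHS.incl F h = 0) :
    h = 0 := by
  have h1 : ∀ g : RKHS F, inner ℝ g h = 0 := by
    intro g
    induction g using UniformSpace.Completion.induction_on with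
    | hp => exact isClosed_eq (by fun_prop) (by fun_prop)
    | ih a =>
      obtain ⟨xs, rfl⟩ := (PreRKHS.of F).surjective a
      have := RKHS.inner_istar_left F xs h
      rw [hh, map_zero, RKHS.istar] at this
      exact this
  exact inner_self_eq_zero.1 (h1 h)

/-- The image `i* D(A*)` of the domain of the adjoint of `A`. -/
def istarAdjointDomain (Q : NonnegSymmOp X) (A : X →ₗ.[ℝ] X) : Submodule ℝ (RKHS Q) where
  carrier := {h | ∃ xs ys : StrongDual ℝ X, IsAdjointAt A xs ys ∧ RKHS.istar Q xs = h}
  zero_mem' := ⟨0, 0, fun _ => rfl, by simpa using RKHS.istar_smul Q 0 0⟩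
  add_mem' := by
    rintro _ _ ⟨xs, ys, h, rfl⟩ ⟨xs', ys', h', rfl⟩
    exact ⟨xs + xs', ys + ys', fun x => by simp [h x, h' x], RKHS.istar_add _ _ _⟩
  smul_mem' := by
    rintro c _ ⟨xs, ys, h, rfl⟩
    exact ⟨c • xs, c • ys, fun x => by simp [h x], RKHS.istar_smul _ _ _⟩

theorem dense_istarAdjointDomain {T : ℝ≥0 → X →L[ℝ] X} {A : X →ₗ.[ℝ] X}
    (hT : IsContractionSemigroup T) (hA : IsGenerator A T) (Q : NonnegSymmOp X) :
    Dense (istarAdjointDomain Q A : Set (RKHS Q)) := by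
  rw [Submodule.dense_iff_topologicalClosure_eq_top, Submodule.topologicalClosure_eq_top_iff,
    Submodule.eq_bot_iff]
  intro v hv
  refine RKHS.eq_zero_of_incl_eq_zero (eq_zero_of_forall_isAdjointAt hT hA fun xs ys h => ?_)
  rw [← RKHS.inner_istar_left]
  exact (Submodule.mem_orthogonal _ _).1 hv _ ⟨xs, ys, h, rfl⟩

/-- The elements of `H` which, in `X`, lie in the range of `Q_∞`. The measure `μ_∞` can be
differentiated along these directions. -/
def rangeDirections (Q Qinf : NonnegSymmOp X) : Submodule ℝ (RKHS Q) where
  carrier := {h | ∃ ys : StrongDual ℝ X, RKHS.incl Q h = Qinf.toCLM ys}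
  zero_mem' := ⟨0, by simp⟩
  add_mem' := by
    rintro h k ⟨ys, hy⟩ ⟨zs, hz⟩
    exact ⟨ys + zs, by simp [hy, hz]⟩
  smul_mem' := by
    rintro c h ⟨ys, hy⟩
    exact ⟨c • ys, by simp [hy]⟩

/-- By the Lyapunov equation, the operator `B : i* xs ↦ i_∞* A* xs` of the analyticity assumption
satisfies `B + B* = -1`, so that a vector orthogonal to its range vanishes. -/
theorem dense_rangeDirections {T : ℝ≥0 → X →L[ℝ] X} {A : X →ₗ.[ℝ] X}
    (hT : IsContractionSemigroup T) (hA : IsGenerator A T) {Q Qinf : NonnegSymmOp X}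
    (hlim : ∀ xs ys : StrongDual ℝ X,
      Tendsto (fun t : ℝ => ys (Qt Q T t xs)) atTop (𝓝 (ys (Qinf.toCLM xs))))
    (hH : AnalyticityAssumption Q Qinf A) :
    Dense (rangeDirections Q Qinf : Set (RKHS Q)) := by
  rw [Submodule.dense_iff_topologicalClosure_eq_top, Submodule.topologicalClosure_eq_top_iff,
    Submodule.eq_bot_iff]
  intro v hv
  obtain ⟨c, hc, hH⟩ := hH
  obtain ⟨w, hwS, hwv⟩ := mem_closure_iff_seq_limit.1 (dense_istarAdjointDomain hT hA Q v)
  have key : ∀ n, ‖w n‖ ^ 2 ≤ 2 * (c * ‖w n‖ * ‖w n - v‖) := by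
    intro n
    obtain ⟨xs, ys, hxy, hw⟩ := hwS n
    obtain ⟨h, h1, h2⟩ := hH xs ys hxy
    rw [RKHS.incl_istar] at h1
    have h3 : inner ℝ h v = 0 := (Submodule.mem_orthogonal _ _).1 hv h ⟨ys, h1⟩
    have h4 : inner ℝ (w n) h = xs (Qinf.toCLM ys) := by
      rw [← hw, RKHS.inner_istar_left, h1]
    have h5 := hxy.lyapunov hT hA hlim
    rw [Qinf.symm, ← h4, ← RKHS.norm_sq_istar, hw] at h5
    -- `2 [w n, h] = -‖w n‖²`, while `h ⊥ v`
    have h6 : inner ℝ h (w n - v) = inner ℝ (w n) h := by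
      rw [inner_sub_right, h3, sub_zero, real_inner_comm]
    have h7 : |inner ℝ h (w n - v)| ≤ c * ‖w n‖ * ‖w n - v‖ := by
      refine (abs_real_inner_le_norm _ _).trans ?_
      rw [hw] at h2
      gcongr
    rw [h6] at h7
    have := neg_abs_le (inner ℝ (w n) h)
    linarith
  have hlim2 : ‖v‖ ^ 2 ≤ 2 * (c * ‖v‖ * ‖v - v‖) :=
    le_of_tendsto_of_tendsto' (hwv.norm.pow 2)
      (((hwv.norm.const_mul c).mul (hwv.sub_const v).norm).const_mul 2) key
  simpa using hlim2

end Directions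

/-! ### Integration by parts for Gaussian measures -/

theorem hasDerivAt_gaussianPDFReal {v : ℝ≥0} (hv : v ≠ 0) (t : ℝ) :
    HasDerivAt (gaussianPDFReal 0 v) (-(t / v) * gaussianPDFReal 0 v t) t := by
  have hv' : (v : ℝ) ≠ 0 := by exact_mod_cast hv
  have h1 : HasDerivAt (fun x : ℝ => -(x - 0) ^ 2 / (2 * v)) (-(t / v)) t := by
    have := (((hasDerivAt_id t).sub_const 0).pow 2).neg.div_const (2 * (v : ℝ))
    convert! this using 1
    simp
    field_simp
  have h2 := (h1.exp).const_mul (√(2 * Real.pi * v))⁻¹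
  rw [gaussianPDFReal_def]
  convert! h2 using 1
  ring

/-- Stein's identity for the centred Gaussian law of variance `v`. -/
theorem integral_id_mul_gaussianReal {v : ℝ≥0} (hv : v ≠ 0) {φ φ' : ℝ → ℝ}
    (hφ : ∀ t, HasDerivAt φ (φ' t) t) (hφ' : Continuous φ') {C D : ℝ} (hC : ∀ t, |φ t| ≤ C)
    (hD : ∀ t, |φ' t| ≤ D) :
    ∫ t, t * φ t ∂gaussianReal 0 v = v * ∫ t, φ' t ∂gaussianReal 0 v := by
  have hv' : (v : ℝ) ≠ 0 := by exact_mod_cast hv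
  have hφc : Continuous φ := continuous_iff_continuousAt.2 fun t => (hφ t).continuousAt
  have hpdf := integrable_gaussianPDFReal 0 v
  have hid : Integrable (fun t => t * gaussianPDFReal 0 v t) := by
    have h1 : Integrable (id : ℝ → ℝ) (gaussianReal 0 v) :=
      (memLp_id_gaussianReal' 1 ENNReal.one_ne_top).integrable le_rfl
    rw [gaussianReal_of_var_ne_zero _ hv, integrable_withDensity_iff_integrable_smul'
      (measurable_gaussianPDF _ _) (ae_of_all _ fun _ => gaussianPDF_lt_top)] at h1
    refine h1.congr (ae_of_all _ fun t => ?_)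
    simp [toReal_gaussianPDF, mul_comm]
  have h := integral_mul_deriv_eq_deriv_mul_of_integrable (u := φ) (v := gaussianPDFReal 0 v)
    (u' := φ') (v' := fun t => -(t / v) * gaussianPDFReal 0 v t) (fun t _ => hφ t)
    (fun t _ => hasDerivAt_gaussianPDFReal hv t)
    (((hid.const_mul (-(v : ℝ)⁻¹)).bdd_mul hφc.aestronglyMeasurable (ae_of_all _ hC)).congr
      (ae_of_all _ fun t => by simp only [Pi.mul_apply]; ring))
    (hpdf.bdd_mul hφ'.aestronglyMeasurable (ae_of_all _ hD))
    (hpdf.bdd_mul hφc.aestronglyMeasurable (ae_of_all _ hC))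
  rw [integral_gaussianReal_eq_integral_smul hv, integral_gaussianReal_eq_integral_smul hv]
  simp only [smul_eq_mul]
  have h1 : ∀ t, gaussianPDFReal 0 v t * (t * φ t) =
      (-(v : ℝ)) * (φ t * (-(t / v) * gaussianPDFReal 0 v t)) := fun t => by field_simp
  simp only [h1, mul_comm (gaussianPDFReal 0 v _) (φ' _)]
  rw [integral_const_mul, h]
  ring

section BddC1

variable {X : Type*} [NormedAddCommGroup X] [NormedSpace ℝ X]

/-- Bounded `C¹` functions on `X` with bounded Fréchet derivative. -/
structure BddC1 (f : X → ℝ) : Prop where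
  contDiff : ContDiff ℝ 1 f
  bdd : ∃ C, ∀ x, |f x| ≤ C
  bdd_fderiv : ∃ C, ∀ x, ‖fderiv ℝ f x‖ ≤ C

theorem BddC1.differentiable {f : X → ℝ} (hf : BddC1 f) : Differentiable ℝ f :=
  hf.contDiff.differentiable one_ne_zero

theorem BddC1.continuous {f : X → ℝ} (hf : BddC1 f) : Continuous f := hf.contDiff.continuous

theorem BddC1.continuous_fderiv {f : X → ℝ} (hf : BddC1 f) : Continuous (fderiv ℝ f) :=
  hf.contDiff.continuous_fderiv one_ne_zero

theorem BddC1.fderiv_mul {f g : X → ℝ} (hf : BddC1 f) (hg : BddC1 g) (x : X) :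
    fderiv ℝ (fun x => f x * g x) x = f x • fderiv ℝ g x + g x • fderiv ℝ f x :=
  fderiv_fun_mul (hf.differentiable x) (hg.differentiable x)

theorem BddC1.mul {f g : X → ℝ} (hf : BddC1 f) (hg : BddC1 g) : BddC1 fun x => f x * g x := by
  obtain ⟨C, hC⟩ := hf.bdd
  obtain ⟨C', hC'⟩ := hf.bdd_fderiv
  obtain ⟨D, hD⟩ := hg.bdd
  obtain ⟨D', hD'⟩ := hg.bdd_fderiv
  have hC0 : 0 ≤ C := (abs_nonneg _).trans (hC 0)
  have hD0 : 0 ≤ D := (abs_nonneg _).trans (hD 0)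
  refine ⟨hf.contDiff.mul hg.contDiff, ⟨C * D, fun x => ?_⟩, C * D' + D * C', fun x => ?_⟩
  · rw [abs_mul]
    exact mul_le_mul (hC x) (hD x) (abs_nonneg _) hC0
  · rw [hf.fderiv_mul hg]
    refine (norm_add_le _ _).trans ?_
    rw [norm_smul, norm_smul, Real.norm_eq_abs, Real.norm_eq_abs]
    exact add_le_add (mul_le_mul (hC x) (hD' x) (norm_nonneg _) hC0)
      (mul_le_mul (hD x) (hC' x) (norm_nonneg _) hD0)

theorem BddC1.fderiv_comp {f : X → ℝ} (hf : BddC1 f) {χ : ℝ → ℝ} (hχ : Differentiable ℝ χ) (x : X) :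
    fderiv ℝ (fun x => χ (f x)) x = deriv χ (f x) • fderiv ℝ f x :=
  ((hχ (f x)).hasDerivAt.comp_hasFDerivAt x (hf.differentiable x).hasFDerivAt).fderiv

theorem BddC1.comp {f : X → ℝ} (hf : BddC1 f) {χ : ℝ → ℝ} (hχ : ContDiff ℝ 1 χ) {C D : ℝ}
    (hC : ∀ t, |χ t| ≤ C) (hD : ∀ t, |deriv χ t| ≤ D) : BddC1 fun x => χ (f x) := by
  obtain ⟨C', hC'⟩ := hf.bdd_fderiv
  refine ⟨hχ.comp hf.contDiff, ⟨C, fun x => hC _⟩, D * C', fun x => ?_⟩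
  rw [hf.fderiv_comp (hχ.differentiable one_ne_zero), norm_smul]
  exact mul_le_mul (hD _) (hC' x) (norm_nonneg _) ((abs_nonneg _).trans (hD 0))

theorem BddC1.continuous_DH (Q : NonnegSymmOp X) {f : X → ℝ} (hf : BddC1 f) :
    Continuous (DH Q f) :=
  (RKHS.istarCLM Q).continuous.comp hf.continuous_fderiv

theorem BddC1.bdd_DH (Q : NonnegSymmOp X) {f : X → ℝ} (hf : BddC1 f) :
    ∃ C, ∀ x, ‖DH Q f x‖ ≤ C := by
  obtain ⟨C, hC⟩ := hf.bdd_fderiv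
  exact ⟨‖RKHS.istarCLM Q‖ * C, fun x => (RKHS.istarCLM Q).le_opNorm_of_le (hC x)⟩

theorem IsFCb1.bddC1 {f : X → ℝ} (hf : IsFCb1 f) : BddC1 f := by
  obtain ⟨n, φ, xs, ⟨h1, h2, D, hD⟩, hf⟩ := hf
  obtain rfl : f = fun x => φ (ContinuousLinearMap.pi xs x) := by
    funext x; rw [hf]; rfl
  refine ⟨h1.comp (ContinuousLinearMap.pi xs).contDiff, ⟨_, fun x => h2.choose_spec _⟩,
    D * ‖ContinuousLinearMap.pi xs‖, fun x => ?_⟩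
  have : fderiv ℝ (fun x => φ (ContinuousLinearMap.pi xs x)) x =
      (fderiv ℝ φ (ContinuousLinearMap.pi xs x)).comp (ContinuousLinearMap.pi xs) :=
    (((h1.differentiable one_ne_zero) _).hasFDerivAt.comp x
      (ContinuousLinearMap.pi xs).hasFDerivAt).fderiv
  rw [this]
  exact (ContinuousLinearMap.opNorm_comp_le _ _).trans (by gcongr; exact hD _)

end BddC1

section Gaussian

variable {X : Type*} [NormedAddCommGroup X] [NormedSpace ℝ X] [MeasurableSpace X] [BorelSpace X]

theorem IsCentredGaussian.map_eq {μ : Measure X} {R : NonnegSymmOp X}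
    (hμ : IsCentredGaussian μ R.toCLM) (ys : StrongDual ℝ X) :
    μ.map ys = gaussianReal 0 (ys (R.toCLM ys)).toNNReal := by
  have := hμ.isGaussian
  rw [IsGaussian.map_eq_gaussianReal ys, hμ.centred, variance_eq_integral ys.continuous.aemeasurable,
    hμ.centred, hμ.covariance]
  simp [pow_two]

variable [CompleteSpace X] [SecondCountableTopology X]

/-- Along the direction `R ys`, a centred Gaussian measure with covariance `R` has logarithmic
derivative `-ys`. The functional `ys` is independent of `x - (ys x / σ²) R ys`, where
`σ² = ⟨R ys, ys⟩`, which reduces the assertion to Stein's identity on the lines in the direction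
`R ys`. -/
theorem IsCentredGaussian.integral_fderiv {μ : Measure X} {R : NonnegSymmOp X}
    (hμ : IsCentredGaussian μ R.toCLM)
    (hnd : ∀ xs : StrongDual ℝ X, xs ≠ 0 → 0 < xs (R.toCLM xs)) {f : X → ℝ} (hf : BddC1 f)
    (ys : StrongDual ℝ X) :
    ∫ x, fderiv ℝ f x (R.toCLM ys) ∂μ = ∫ x, ys x * f x ∂μ := by
  have := hμ.isGaussian
  rcases eq_or_ne ys 0 with rfl | hys
  · simp
  set k := R.toCLM ys with hk
  have hσ : 0 < ys k := hnd ys hys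
  set v : ℝ≥0 := (ys k).toNNReal with hv
  have hv0 : v ≠ 0 := by simpa [hv] using hσ
  have hvc : (v : ℝ) = ys k := Real.coe_toNNReal _ hσ.le
  -- the projection onto `ker ys` along `k`, uncorrelated with `ys`
  set Z : X →L[ℝ] X := ContinuousLinearMap.id ℝ X - (ys k)⁻¹ • ys.smulRight k with hZ
  have hZx : ∀ x, Z x = x - (ys x / ys k) • k := fun x => by
    simp [hZ, smul_smul, div_eq_inv_mul]
  have hZk : Z k = 0 := by rw [hZx, div_self hσ.ne', one_smul, sub_self]
  have hdec : ∀ x, (ys x / ys k) • k + Z x = x := fun x => by rw [hZx]; abel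
  have hgauss : HasGaussianLaw (fun x => (ys x, Z x)) μ :=
    IsGaussian.hasGaussianLaw_id.map (ys.prod Z)
  have hind : IndepFun ys Z μ := by
    refine hgauss.indepFun_of_covariance_strongDual fun L₁ L₂ => ?_
    have h1 := hμ.covariance (L₁.comp ys) (L₂.comp Z)
    have h2 : R.toCLM (L₁.comp ys) = L₁ 1 • k := by
      rw [hk, ← map_smul]
      congr 1
      ext x
      have := L₁.map_smul (ys x) 1
      simp only [smul_eq_mul, mul_one] at this
      simp [this, mul_comm]
    rw [h2, ContinuousLinearMap.comp_apply, map_smul, hZk, smul_zero, map_zero] at h1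
    rw [ProbabilityTheory.covariance]
    have h3 : ∫ x, (L₁ ∘ ys) x ∂μ = 0 := hμ.centred (L₁.comp ys)
    have h4 : ∫ x, (L₂ ∘ Z) x ∂μ = 0 := hμ.centred (L₂.comp Z)
    rw [h3, h4]
    simpa using h1.symm
  have hprod := (indepFun_iff_map_prod_eq_prod_map_map ys.continuous.aemeasurable
    Z.continuous.aemeasurable).1 hind
  rw [hμ.map_eq ys] at hprod
  have : IsProbabilityMeasure (μ.map Z) := Measure.isProbabilityMeasure_map Z.continuous.aemeasurable
  have hmeas : Measurable fun x => (ys x, Z x) := (ys.prod Z).continuous.measurable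
  -- disintegration of `μ` along the lines parallel to `k`
  have hdis : ∀ g : ℝ × X → ℝ, Continuous g → Integrable (fun x => g (ys x, Z x)) μ →
      ∫ x, g (ys x, Z x) ∂μ = ∫ z, ∫ t, g (t, z) ∂gaussianReal 0 v ∂μ.map Z := by
    intro g hg hgi
    rw [← integral_map hmeas.aemeasurable hg.aestronglyMeasurable, hprod, integral_prod_symm]
    rw [← hprod]
    exact (integrable_map_measure hg.aestronglyMeasurable hmeas.aemeasurable).2 hgi
  obtain ⟨C, hC⟩ := hf.bdd
  obtain ⟨D, hD⟩ := hf.bdd_fderiv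
  have hDk : ∀ x, |fderiv ℝ f x k| ≤ D * ‖k‖ := fun x =>
    (fderiv ℝ f x).le_of_opNorm_le (hD x) k
  have hcl : Continuous fun q : ℝ × X => (q.1 / ys k) • k + q.2 := by fun_prop
  have hfk : Continuous fun x => fderiv ℝ f x k := hf.continuous_fderiv.clm_apply continuous_const
  have e1 := hdis (fun q => fderiv ℝ f ((q.1 / ys k) • k + q.2) k) (hfk.comp hcl) (by
    simp only [hdec]
    exact Integrable.of_bound hfk.aestronglyMeasurable _ (ae_of_all _ hDk))
  have e2 := hdis (fun q => q.1 * f ((q.1 / ys k) • k + q.2))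
    (continuous_fst.mul (hf.continuous.comp hcl)) (by
    simp only [hdec]
    exact (IsGaussian.integrable_dual μ ys).mul_bdd hf.continuous.aestronglyMeasurable
      (ae_of_all _ hC))
  simp only [hdec] at e1 e2
  rw [e1, e2]
  refine integral_congr_ae (ae_of_all _ fun z => ?_)
  have hline : ∀ t : ℝ, HasDerivAt (fun t : ℝ => f ((t / ys k) • k + z))
      ((ys k)⁻¹ * fderiv ℝ f ((t / ys k) • k + z) k) t := by
    intro t
    have h1 : HasDerivAt (fun t : ℝ => (t / ys k) • k + z) ((ys k)⁻¹ • k) t := by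
      have := (((hasDerivAt_id t).div_const (ys k)).smul_const k).add_const z
      simpa using this
    have := (hf.differentiable ((t / ys k) • k + z)).hasFDerivAt.comp_hasDerivAt t h1
    rw [map_smul, smul_eq_mul] at this
    exact this
  have hs := integral_id_mul_gaussianReal hv0 hline
    (continuous_const.mul (hfk.comp (by fun_prop))) (C := C) (D := |(ys k)⁻¹| * (D * ‖k‖))
    (fun t => hC _) (fun t => by rw [abs_mul]; gcongr; exact hDk _)
  simp only
  rw [hs, integral_const_mul, hvc, mul_inv_cancel_left₀ hσ.ne']

end Gaussian

/-! ### Integration by parts with a Sobolev weight -/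

theorem tendsto_integral_mul_of_tendsto_ae {α : Type*} [MeasurableSpace α] {μ : Measure α}
    {m d : ℕ → α → ℝ} {m₀ d₀ : α → ℝ} {C : ℝ} (hm : ∀ n, AEStronglyMeasurable (m n) μ)
    (hmC : ∀ n x, |m n x| ≤ C) (hm₀ : ∀ᵐ x ∂μ, Tendsto (fun n => m n x) atTop (𝓝 (m₀ x)))
    (hd : ∀ n, Integrable (d n) μ) (hd₀ : Integrable d₀ μ)
    (hdlim : Tendsto (fun n => ∫ x, |d n x - d₀ x| ∂μ) atTop (𝓝 0)) :
    Tendsto (fun n => ∫ x, m n x * d n x ∂μ) atTop (𝓝 (∫ x, m₀ x * d₀ x ∂μ)) := by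
  have h1 : Tendsto (fun n => ∫ x, m n x * d₀ x ∂μ) atTop (𝓝 (∫ x, m₀ x * d₀ x ∂μ)) := by
    refine tendsto_integral_of_dominated_convergence (fun x => C * |d₀ x|)
      (fun n => (hm n).mul hd₀.1) (hd₀.abs.const_mul C) (fun n => ae_of_all _ fun x => ?_) ?_
    · rw [Real.norm_eq_abs, abs_mul]
      exact mul_le_mul_of_nonneg_right (hmC n x) (abs_nonneg _)
    · filter_upwards [hm₀] with x hx using hx.mul_const _
  have h2 : Tendsto (fun n => ∫ x, m n x * (d n x - d₀ x) ∂μ) atTop (𝓝 0) := by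
    refine squeeze_zero_norm (fun n => ?_) (by simpa using hdlim.const_mul C)
    rw [← integral_const_mul]
    refine norm_integral_le_of_norm_le (((hd n).sub hd₀).abs.const_mul C)
      (ae_of_all _ fun x => ?_)
    rw [Real.norm_eq_abs, abs_mul]
    exact mul_le_mul_of_nonneg_right (hmC n x) (abs_nonneg _)
  refine (by simpa using h2.add h1 : Tendsto _ atTop (𝓝 (∫ x, m₀ x * d₀ x ∂μ))).congr fun n => ?_
  have h3 : Integrable (fun x => m n x * (d n x - d₀ x)) μ :=
    ((hd n).sub hd₀).bdd_mul (hm n) (ae_of_all _ (hmC n))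
  rw [← integral_add h3 (hd₀.bdd_mul (hm n) (ae_of_all _ (hmC n)))]
  simp only [mul_sub, sub_add_cancel]

section Weight

variable {X : Type*} [NormedAddCommGroup X] [NormedSpace ℝ X]

theorem inner_DH [CompleteSpace X] (Q : NonnegSymmOp X) (f : X → ℝ) (x : X) (h : RKHS Q) :
    inner ℝ (DH Q f x) h = fderiv ℝ f x (RKHS.incl Q h) :=
  RKHS.inner_istar_left Q _ h

variable [MeasurableSpace X]

/-- Approximation of a Sobolev function by cylindrical functions, almost everywhere for the values
and in `L¹` for the gradients. -/
theorem MemSobolev.exists_seq {Q : NonnegSymmOp X} {μ : Measure X} [IsProbabilityMeasure μ]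
    {q : ℝ≥0∞} [Fact (1 ≤ q)] {u : X → ℝ} (hu : MemSobolev Q μ q u) :
    ∃ (un : ℕ → X → ℝ) (V : X → RKHS Q), (∀ n, IsFCb1 (un n)) ∧ MemLp V q μ ∧
      (∀ᵐ x ∂μ, Tendsto (fun n => un n x) atTop (𝓝 (u x))) ∧
      Tendsto (fun n => ∫ x, ‖DH Q (un n) x - V x‖ ∂μ) atTop (𝓝 0) := by
  obtain ⟨hu, V, hV⟩ := hu
  rw [← SetLike.mem_coe, Submodule.topologicalClosure_coe] at hV
  obtain ⟨w, hw, hlim⟩ := mem_closure_iff_seq_limit.1 hV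
  choose f hf hf1 hf2 using hw
  have h1 : Tendsto (fun n => (w n).1) atTop (𝓝 (hu.toLp u)) :=
    (continuous_fst.tendsto _).comp hlim
  have h2 : Tendsto (fun n => (w n).2) atTop (𝓝 V) := (continuous_snd.tendsto _).comp hlim
  obtain ⟨ns, hns, hae⟩ := (tendstoInMeasure_of_tendsto_Lp h1).exists_seq_tendsto_ae
  refine ⟨fun n => f (ns n), V, fun n => hf _, Lp.memLp V, ?_, ?_⟩
  · filter_upwards [hae, hu.coeFn_toLp, ae_all_iff.2 fun n => hf1 (ns n)] with x hx1 hx2 hx3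
    rw [hx2] at hx1
    exact hx1.congr hx3
  · have h3 := (h2.comp hns.tendsto_atTop).sub_const V |>.norm
    rw [sub_self, norm_zero] at h3
    refine squeeze_zero (fun n => integral_nonneg fun x => norm_nonneg _) (fun n => ?_) h3
    have h4 : ∫ x, ‖DH Q (f (ns n)) x - V x‖ ∂μ = ∫ x, ‖((w (ns n)).2 - V : Lp (RKHS Q) q μ) x‖ ∂μ := by
      refine integral_congr_ae ?_
      filter_upwards [hf2 (ns n), Lp.coeFn_sub (w (ns n)).2 V] with x hx1 hx2
      rw [hx2, Pi.sub_apply, hx1]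
    rw [h4, integral_norm_eq_lintegral_enorm (Lp.aestronglyMeasurable _),
      ← eLpNorm_one_eq_lintegral_enorm]
    exact ENNReal.toReal_mono (Lp.eLpNorm_ne_top _)
      (eLpNorm_le_eLpNorm_of_exponent_le Fact.out (Lp.aestronglyMeasurable _))

variable [CompleteSpace X] [SecondCountableTopology X] [BorelSpace X]

/-- Integration by parts for `μ` in the direction `h`, with the weight `χ(u)`, where `u` is a Sobolev
function with generalized gradient `V`. -/
theorem exists_gradient_integral_DH {Q Qinf : NonnegSymmOp X} {μ : Measure X}
    (hμ : IsCentredGaussian μ Qinf.toCLM)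
    (hnd : ∀ xs : StrongDual ℝ X, xs ≠ 0 → 0 < xs (Qinf.toCLM xs))
    {q : ℝ≥0∞} [Fact (1 ≤ q)] {u : X → ℝ} (hu : MemSobolev Q μ q u) :
    ∃ V : X → RKHS Q, MemLp V q μ ∧
      ∀ (f g : X → ℝ) (χ : ℝ → ℝ) (C D : ℝ) (h : RKHS Q) (ys : StrongDual ℝ X),
        BddC1 f → BddC1 g → ContDiff ℝ 1 χ → (∀ t, |χ t| ≤ C) → (∀ t, |deriv χ t| ≤ D) →
        RKHS.incl Q h = Qinf.toCLM ys →
        ∫ x, inner ℝ (DH Q f x) h * (g x * χ (u x)) ∂μ =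
          ∫ x, f x * (g x * χ (u x) * ys x - χ (u x) * inner ℝ (DH Q g x) h -
            g x * deriv χ (u x) * inner ℝ (V x) h) ∂μ := by
  have := hμ.isGaussian
  obtain ⟨un, V, hun, hV, hae, hgrad⟩ := hu.exists_seq
  refine ⟨V, hV, fun f g χ C D h ys hf hg hχ hC hD hh => ?_⟩
  have hχ' : Continuous (deriv χ) := hχ.continuous_deriv le_rfl
  obtain ⟨Cf, hCf⟩ := hf.bdd
  obtain ⟨Cg, hCg⟩ := hg.bdd
  have hCf0 : 0 ≤ Cf := (abs_nonneg _).trans (hCf 0)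
  have hCg0 : 0 ≤ Cg := (abs_nonneg _).trans (hCg 0)
  have hC0 : 0 ≤ C := (abs_nonneg _).trans (hC 0)
  have hD0 : 0 ≤ D := (abs_nonneg _).trans (hD 0)
  set k := Qinf.toCLM ys with hk
  have hdk : ∀ {v : X → ℝ}, BddC1 v → Integrable (fun x => fderiv ℝ v x k) μ := by
    intro v hv
    obtain ⟨D', hD'⟩ := hv.bdd_fderiv
    exact Integrable.of_bound
      (hv.continuous_fderiv.clm_apply continuous_const).aestronglyMeasurable (D' * ‖k‖)
      (ae_of_all _ fun x => (fderiv ℝ v x).le_of_opNorm_le (hD' x) k)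
  have hVh : Integrable (fun x => inner ℝ (V x) h) μ :=
    (hV.integrable Fact.out).inner_const h
  have hys : Integrable ys μ := IsGaussian.integrable_dual μ ys
  have hgradh : Tendsto (fun n => ∫ x, |fderiv ℝ (un n) x k - inner ℝ (V x) h| ∂μ) atTop (𝓝 0) := by
    have hint : ∀ n, Integrable (fun x => DH Q (un n) x - V x) μ := by
      intro n
      refine Integrable.sub ?_ (hV.integrable Fact.out)
      obtain ⟨D', hD'⟩ := (hun n).bddC1.bdd_DH Q
      exact Integrable.of_bound ((hun n).bddC1.continuous_DH Q).aestronglyMeasurable D'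
        (ae_of_all _ hD')
    refine squeeze_zero (fun n => integral_nonneg fun x => abs_nonneg _) (fun n => ?_)
      (by simpa using hgrad.const_mul ‖h‖)
    rw [← integral_const_mul]
    refine integral_mono ((hdk (hun n).bddC1).sub hVh).abs ((hint n).norm.const_mul _) fun x => ?_
    simp only
    rw [← hh, ← inner_DH, ← inner_sub_left, mul_comm]
    exact abs_real_inner_le_norm _ _
  have hconst : ∀ d : X → ℝ, Tendsto (fun _ : ℕ => ∫ x, |d x - d x| ∂μ) atTop (𝓝 0) := fun d => by
    simp
  have huc : ∀ n, Continuous (un n) := fun n => (hun n).bddC1.continuous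
  have hχu : ∀ᵐ x ∂μ, Tendsto (fun n => χ (un n x)) atTop (𝓝 (χ (u x))) := by
    filter_upwards [hae] with x hx using (hχ.continuous.tendsto _).comp hx
  have hχu' : ∀ᵐ x ∂μ, Tendsto (fun n => deriv χ (un n x)) atTop (𝓝 (deriv χ (u x))) := by
    filter_upwards [hae] with x hx using (hχ'.tendsto _).comp hx
  have hmA : ∀ n x, |f x * (g x * deriv χ (un n x))| ≤ Cf * (Cg * D) := fun n x => by
    rw [abs_mul, abs_mul]
    exact mul_le_mul (hCf x) (mul_le_mul (hCg x) (hD _) (abs_nonneg _) hCg0) (by positivity) hCf0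
  have hmB : ∀ n x, |f x * χ (un n x)| ≤ Cf * C := fun n x => by
    rw [abs_mul]; exact mul_le_mul (hCf x) (hC _) (abs_nonneg _) hCf0
  have hmC : ∀ n x, |g x * χ (un n x)| ≤ Cg * C := fun n x => by
    rw [abs_mul]; exact mul_le_mul (hCg x) (hC _) (abs_nonneg _) hCg0
  have hmD : ∀ n x, |f x * (g x * χ (un n x))| ≤ Cf * (Cg * C) := fun n x => by
    rw [abs_mul]; exact mul_le_mul (hCf x) (hmC n x) (abs_nonneg _) hCf0
  have cA : ∀ n, Continuous fun x => f x * (g x * deriv χ (un n x)) := fun n =>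
    hf.continuous.mul (hg.continuous.mul (hχ'.comp (huc n)))
  have cB : ∀ n, Continuous fun x => f x * χ (un n x) := fun n =>
    hf.continuous.mul (hχ.continuous.comp (huc n))
  have cC : ∀ n, Continuous fun x => g x * χ (un n x) := fun n =>
    hg.continuous.mul (hχ.continuous.comp (huc n))
  have cD : ∀ n, Continuous fun x => f x * (g x * χ (un n x)) := fun n =>
    hf.continuous.mul (cC n)
  have lA := tendsto_integral_mul_of_tendsto_ae (fun n => (cA n).aestronglyMeasurable) hmA
    (m₀ := fun x => f x * (g x * deriv χ (u x)))
    (by filter_upwards [hχu'] with x hx using (hx.const_mul _).const_mul _)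
    (fun n => hdk (hun n).bddC1) hVh hgradh
  have lB := tendsto_integral_mul_of_tendsto_ae (fun n => (cB n).aestronglyMeasurable) hmB
    (m₀ := fun x => f x * χ (u x)) (by filter_upwards [hχu] with x hx using hx.const_mul _)
    (fun _ => hdk hg) (hdk hg) (hconst _)
  have lC := tendsto_integral_mul_of_tendsto_ae (fun n => (cC n).aestronglyMeasurable) hmC
    (m₀ := fun x => g x * χ (u x)) (by filter_upwards [hχu] with x hx using hx.const_mul _)
    (fun _ => hdk hf) (hdk hf) (hconst _)
  have lD := tendsto_integral_mul_of_tendsto_ae (fun n => (cD n).aestronglyMeasurable) hmD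
    (m₀ := fun x => f x * (g x * χ (u x)))
    (by filter_upwards [hχu] with x hx using (hx.const_mul _).const_mul _)
    (fun _ => hys) hys (hconst _)
  -- integration by parts for the smooth product `f g χ(uₙ)`
  have hn : ∀ n, ∫ x, g x * χ (un n x) * fderiv ℝ f x k ∂μ =
      ∫ x, f x * (g x * χ (un n x)) * ys x ∂μ - ∫ x, f x * χ (un n x) * fderiv ℝ g x k ∂μ -
        ∫ x, f x * (g x * deriv χ (un n x)) * fderiv ℝ (un n) x k ∂μ := by
    intro n
    have hun' := (hun n).bddC1
    have hcomp := hun'.comp hχ hC hD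
    have h1 := hμ.integral_fderiv hnd (hf.mul (hg.mul hcomp)) ys
    have h2 : ∀ x, fderiv ℝ (fun x => f x * (g x * χ (un n x))) x k =
        g x * χ (un n x) * fderiv ℝ f x k + f x * χ (un n x) * fderiv ℝ g x k +
          f x * (g x * deriv χ (un n x)) * fderiv ℝ (un n) x k := by
      intro x
      rw [hf.fderiv_mul (hg.mul hcomp), hg.fderiv_mul hcomp,
        hun'.fderiv_comp (hχ.differentiable one_ne_zero)]
      simp only [_root_.add_apply, _root_.smul_apply, smul_eq_mul]
      ring
    simp only [← hk, h2] at h1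
    rw [integral_add, integral_add] at h1
    · simp only [mul_comm (ys _)] at h1
      linarith
    · exact (hdk hf).bdd_mul (cC n).aestronglyMeasurable (ae_of_all _ (hmC n))
    · exact (hdk hg).bdd_mul (cB n).aestronglyMeasurable (ae_of_all _ (hmB n))
    · exact ((hdk hf).bdd_mul (cC n).aestronglyMeasurable (ae_of_all _ (hmC n))).add
        ((hdk hg).bdd_mul (cB n).aestronglyMeasurable (ae_of_all _ (hmB n)))
    · exact (hdk hun').bdd_mul (cA n).aestronglyMeasurable (ae_of_all _ (hmA n))
  have hlim := tendsto_nhds_unique lC (((lD.sub lB).sub lA).congr fun n => (hn n).symm)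
  have hum : AEStronglyMeasurable u μ := hu.choose.1
  have mχ : AEStronglyMeasurable (fun x => χ (u x)) μ := hχ.continuous.comp_aestronglyMeasurable hum
  have mχ' : AEStronglyMeasurable (fun x => deriv χ (u x)) μ := hχ'.comp_aestronglyMeasurable hum
  have mf := hf.continuous.aestronglyMeasurable (μ := μ)
  have mg := hg.continuous.aestronglyMeasurable (μ := μ)
  have iA : Integrable (fun x => f x * (g x * deriv χ (u x)) * inner ℝ (V x) h) μ :=
    hVh.bdd_mul (mf.mul (mg.mul mχ')) (c := Cf * (Cg * D)) (ae_of_all _ fun x => by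
      rw [Real.norm_eq_abs, abs_mul, abs_mul]
      exact mul_le_mul (hCf x) (mul_le_mul (hCg x) (hD _) (abs_nonneg _) hCg0) (by positivity) hCf0)
  have iB : Integrable (fun x => f x * χ (u x) * fderiv ℝ g x k) μ :=
    (hdk hg).bdd_mul (mf.mul mχ) (c := Cf * C) (ae_of_all _ fun x => by
      rw [Real.norm_eq_abs, abs_mul]; exact mul_le_mul (hCf x) (hC _) (abs_nonneg _) hCf0)
  have iD : Integrable (fun x => f x * (g x * χ (u x)) * ys x) μ :=
    hys.bdd_mul (mf.mul (mg.mul mχ)) (c := Cf * (Cg * C)) (ae_of_all _ fun x => by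
      rw [Real.norm_eq_abs, abs_mul, abs_mul]
      exact mul_le_mul (hCf x) (mul_le_mul (hCg x) (hC _) (abs_nonneg _) hCg0) (by positivity) hCf0)
  have iDB : Integrable (fun x => f x * (g x * χ (u x)) * ys x - f x * χ (u x) * fderiv ℝ g x k) μ :=
    iD.sub iB
  calc ∫ x, inner ℝ (DH Q f x) h * (g x * χ (u x)) ∂μ
      = ∫ x, g x * χ (u x) * fderiv ℝ f x k ∂μ := by
        simp only [inner_DH, hh, mul_comm]
    _ = _ := by
      rw [hlim, ← integral_sub iD iB, ← integral_sub iDB iA]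
      refine integral_congr_ae (ae_of_all _ fun x => ?_)
      simp only [inner_DH, hh]
      ring

end Weight

/-! ### The weighted measure -/

section WeightedMeasure

variable {X : Type*} [NormedAddCommGroup X] [NormedSpace ℝ X]

/-- A proper, lower semicontinuous, convex function has a continuous affine minorant: separate a
point below the graph from the epigraph. -/
theorem exists_affine_le {U : X → EReal} (hbot : ∀ x, U x ≠ ⊥) (hprop : ∃ x, U x ≠ ⊤)
    (hlsc : LowerSemicontinuous U) (hconv : Convex ℝ {q : X × ℝ | U q.1 ≤ q.2}) :
    ∃ (L : StrongDual ℝ X) (c : ℝ), ∀ x, ((L x + c : ℝ) : EReal) ≤ U x := by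
  obtain ⟨x₀, hx₀⟩ := hprop
  set E := {q : X × ℝ | U q.1 ≤ q.2} with hE
  have hEcl : IsClosed E :=
    hlsc.isClosed_epigraph.preimage (f := fun q : X × ℝ => (q.1, (q.2 : EReal)))
      (continuous_fst.prodMk (continuous_coe_real_ereal.comp continuous_snd))
  have hmem : ∀ x, U x ≠ ⊤ → (x, (U x).toReal) ∈ E := fun x hx =>
    (EReal.coe_toReal hx (hbot x)).ge
  have hnot : (x₀, (U x₀).toReal - 1) ∉ E := by
    intro h
    have h1 : U x₀ ≤ (((U x₀).toReal - 1 : ℝ) : EReal) := h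
    rw [← EReal.coe_toReal hx₀ (hbot x₀), EReal.coe_le_coe_iff, EReal.toReal_coe] at h1
    linarith
  obtain ⟨f, s, hfs, hf⟩ := geometric_hahn_banach_point_closed hconv hEcl hnot
  set L : StrongDual ℝ X := f.comp (ContinuousLinearMap.inl ℝ X ℝ) with hL
  set a : ℝ := f (0, 1) with ha
  have hdec : ∀ (x : X) (r : ℝ), f (x, r) = L x + a * r := by
    intro x r
    have h1 : (x, r) = (x, (0 : ℝ)) + r • ((0 : X), (1 : ℝ)) := by simp
    rw [h1, map_add, map_smul, smul_eq_mul, mul_comm]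
    rfl
  have ha0 : 0 < a := by
    have h1 := hf _ (hmem x₀ hx₀)
    rw [hdec] at hfs h1
    linarith
  refine ⟨-(a⁻¹ • L), s / a, fun x => ?_⟩
  rcases eq_or_ne (U x) ⊤ with hx | hx
  · rw [hx]; exact le_top
  · have h1 := hf _ (hmem x hx)
    rw [hdec] at h1
    rw [← EReal.coe_toReal hx (hbot x), EReal.coe_le_coe_iff]
    have h2 : (-(a⁻¹ • L)) x + s / a = (s - L x) / a := by
      simp only [_root_.neg_apply, _root_.smul_apply, smul_eq_mul]
      field_simp
      ring
    rw [h2, div_le_iff₀ ha0]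
    linarith

variable [MeasurableSpace X] {Q : NonnegSymmOp X} {μ : Measure X} {U : X → EReal}

/-- The value of `(U x).toReal` at `U x = ⊤` is immaterial, as `U` is finite almost everywhere. -/
theorem WeightAssumption.ae_exp_eq (hU : WeightAssumption Q μ U) :
    ∀ᵐ x ∂μ, (-U x).exp = ENNReal.ofReal (Real.exp (-(U x).toReal)) := by
  filter_upwards [hU.ae_finite] with x hx
  rw [← EReal.exp_coe, EReal.coe_neg, EReal.coe_toReal hx (hU.ne_bot x)]

variable [BorelSpace X]

theorem isFiniteMeasure_weightedMeasure {R : NonnegSymmOp X}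
    (hμ : IsCentredGaussian μ R.toCLM)
    (hU : WeightAssumption Q μ U) : IsFiniteMeasure (weightedMeasure μ U) := by
  obtain ⟨L, c, hLc⟩ := exists_affine_le hU.ne_bot hU.proper hU.lsc hU.convex
  have h1 : Integrable (fun x => Real.exp (-(L x + c))) μ := by
    have h2 := (integrable_exp_mul_gaussianReal (μ := 0) (v := (L (R.toCLM L)).toNNReal) (-1))
    rw [← hμ.map_eq L, integrable_map_measure (by fun_prop) L.continuous.aemeasurable] at h2
    refine (h2.const_mul (Real.exp (-c))).congr (ae_of_all _ fun x => ?_)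
    simp only [Function.comp_apply, ← Real.exp_add]
    ring_nf
  refine isFiniteMeasure_withDensity (ne_of_lt (lt_of_le_of_lt (lintegral_mono fun x => ?_)
    ((hasFiniteIntegral_iff_ofReal (ae_of_all _ fun x => (Real.exp_pos _).le)).1 h1.2)))
  rw [← EReal.exp_coe, EReal.exp_le_exp_iff, EReal.coe_neg, EReal.neg_le_neg_iff]
  exact hLc x

theorem WeightAssumption.measurable (hU : WeightAssumption Q μ U) : Measurable U :=
  hU.lsc.measurable

theorem WeightAssumption.measurable_exp (hU : WeightAssumption Q μ U) :
    Measurable fun x => (-U x).exp :=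
  EReal.measurable_exp.comp hU.measurable.neg

theorem WeightAssumption.integral_eq (hU : WeightAssumption Q μ U) (F : X → ℝ) :
    ∫ x, F x ∂weightedMeasure μ U = ∫ x, Real.exp (-(U x).toReal) * F x ∂μ := by
  rw [weightedMeasure, integral_withDensity_eq_integral_toReal_smul hU.measurable_exp]
  · refine integral_congr_ae ?_
    filter_upwards [hU.ae_exp_eq] with x hx
    rw [hx, ENNReal.toReal_ofReal (Real.exp_pos _).le, smul_eq_mul]
  · filter_upwards [hU.ae_exp_eq] with x hx
    rw [hx]
    exact ENNReal.ofReal_lt_top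

/-- On a sublevel set of `|U|` the density `e^{-U}` is bounded, so that functions supported there
inherit their integrability from `μ`. -/
theorem WeightAssumption.memLp_of_support (hU : WeightAssumption Q μ U) {F : X → ℝ} {q : ℝ≥0∞}
    {M : ℝ} (hF : MemLp F q μ) (hsupp : ∀ x, M < |(U x).toReal| → F x = 0) :
    MemLp F q (weightedMeasure μ U) := by
  set S : Set X := {x | |(U x).toReal| ≤ M} with hS
  have hSm : MeasurableSet S := measurableSet_le (by
    have := hU.measurable.ereal_toReal
    fun_prop) measurable_const
  have hFS : F = S.indicator F := by
    refine (Set.indicator_eq_self.2 fun x hx => ?_).symm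
    by_contra h
    exact hx (hsupp x (not_le.1 h))
  rw [hFS, memLp_indicator_iff_restrict hSm]
  refine (hF.restrict S).of_measure_le_smul (c := ENNReal.ofReal (Real.exp M)) ENNReal.ofReal_ne_top ?_
  rw [weightedMeasure, restrict_withDensity hSm, ← withDensity_const]
  refine withDensity_mono ?_
  filter_upwards [ae_restrict_mem hSm, ae_restrict_of_ae hU.ae_exp_eq] with x hx1 hx2
  rw [hx2]
  gcongr
  exact (neg_le_abs _).trans hx1

end WeightedMeasure

/-! ### Cylindrical functions separate integrable functions -/

section Separation

variable {X : Type*} [NormedAddCommGroup X] [NormedSpace ℝ X]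

theorem IsFCb1.comp_dual {φ φ' : ℝ → ℝ} (hφ : ∀ t, HasDerivAt φ (φ' t) t) (hφ' : Continuous φ')
    {C D : ℝ} (hC : ∀ t, |φ t| ≤ C) (hD : ∀ t, |φ' t| ≤ D) (xs : StrongDual ℝ X) :
    IsFCb1 fun x => φ (xs x) := by
  have hd : ∀ ξ : Fin 1 → ℝ, HasFDerivAt (fun ξ : Fin 1 → ℝ => φ (ξ 0))
      (φ' (ξ 0) • (ContinuousLinearMap.proj 0 : (Fin 1 → ℝ) →L[ℝ] ℝ)) ξ := fun ξ =>
    (hφ (ξ 0)).comp_hasFDerivAt ξ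
      (ContinuousLinearMap.proj 0 : (Fin 1 → ℝ) →L[ℝ] ℝ).hasFDerivAt
  have hφ1 : ContDiff ℝ 1 φ := by
    refine contDiff_one_iff_deriv.2 ⟨fun t => (hφ t).differentiableAt, ?_⟩
    rwa [funext fun t => (hφ t).deriv]
  refine ⟨1, fun ξ => φ (ξ 0), fun _ => xs,
    ⟨hφ1.comp (contDiff_apply ℝ ℝ 0), ⟨C, fun ξ => hC _⟩,
      D * ‖(ContinuousLinearMap.proj 0 : (Fin 1 → ℝ) →L[ℝ] ℝ)‖, fun ξ => ?_⟩, fun x => rfl⟩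
  rw [(hd ξ).fderiv, norm_smul]
  gcongr
  exact hD _

theorem IsFCb1.cos (xs : StrongDual ℝ X) : IsFCb1 fun x => Real.cos (xs x) :=
  .comp_dual Real.hasDerivAt_cos Real.continuous_sin.neg Real.abs_cos_le_one
    (fun t => (abs_neg _).trans_le (Real.abs_sin_le_one t)) xs

theorem IsFCb1.sin (xs : StrongDual ℝ X) : IsFCb1 fun x => Real.sin (xs x) :=
  .comp_dual Real.hasDerivAt_sin Real.continuous_cos Real.abs_sin_le_one Real.abs_cos_le_one xs

variable [MeasurableSpace X] [BorelSpace X]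

theorem IsFCb1.memLp {ν : Measure X} [IsFiniteMeasure ν] {p : ℝ≥0∞} {f : X → ℝ} (hf : IsFCb1 f) :
    MemLp f p ν := by
  obtain ⟨C, hC⟩ := hf.bddC1.bdd
  exact MemLp.of_bound hf.bddC1.continuous.aestronglyMeasurable C (ae_of_all _ hC)

variable [SecondCountableTopology X]

theorem IsFCb1.memLp_DH {ν : Measure X} [IsFiniteMeasure ν] {p : ℝ≥0∞} {Q : NonnegSymmOp X}
    {f : X → ℝ} (hf : IsFCb1 f) : MemLp (DH Q f) p ν := by
  obtain ⟨C, hC⟩ := hf.bddC1.bdd_DH Q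
  exact MemLp.of_bound (hf.bddC1.continuous_DH Q).aestronglyMeasurable C (ae_of_all _ hC)

variable [CompleteSpace X]

/-- The positive and negative parts of `F` define finite measures with equal characteristic
functionals. -/
theorem ae_eq_zero_of_forall_integral_mul_eq_zero {ν : Measure X} [IsFiniteMeasure ν] {F : X → ℝ}
    (hF : Integrable F ν) (h : ∀ g : X → ℝ, IsFCb1 g → ∫ x, F x * g x ∂ν = 0) : F =ᵐ[ν] 0 := by
  have hfin : ∀ {G : X → ℝ}, Integrable G ν → ∫⁻ x, ENNReal.ofReal (G x) ∂ν ≠ ∞ := fun hG =>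
    hG.lintegral_lt_top.ne
  have hm : ∀ {G : X → ℝ}, Integrable G ν → AEMeasurable (fun x => ENNReal.ofReal (G x)) ν :=
    fun hG => hG.1.aemeasurable.ennreal_ofReal
  have := isFiniteMeasure_withDensity (hfin hF)
  have := isFiniteMeasure_withDensity (hfin hF.neg)
  have hchar : ∀ {G : X → ℝ}, Integrable G ν → ∀ L : StrongDual ℝ X,
      charFunDual (ν.withDensity fun x => ENNReal.ofReal (G x)) L =
        ∫ x, ((max (G x) 0 : ℝ) : ℂ) * Complex.exp (L x * Complex.I) ∂ν := by
    intro G hG L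
    rw [charFunDual_apply, integral_withDensity_eq_integral_toReal_smul₀ (hm hG)
      (ae_of_all _ fun x => ENNReal.ofReal_lt_top)]
    simp only [ENNReal.toReal_ofReal', Complex.real_smul]
  have hint : ∀ {G : X → ℝ}, Integrable G ν → ∀ L : StrongDual ℝ X,
      Integrable (fun x => ((max (G x) 0 : ℝ) : ℂ) * Complex.exp (L x * Complex.I)) ν := by
    intro G hG L
    refine hG.pos_part.ofReal.mul_bdd (c := 1) (by
      have := L.continuous
      exact Continuous.aestronglyMeasurable (by fun_prop)) (ae_of_all _ fun x => ?_)
    rw [Complex.norm_exp_ofReal_mul_I]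
  have heq : ν.withDensity (fun x => ENNReal.ofReal (F x)) =
      ν.withDensity fun x => ENNReal.ofReal ((-F) x) := by
    refine Measure.ext_of_charFunDual (funext fun L => ?_)
    rw [hchar hF, hchar hF.neg, ← sub_eq_zero, ← integral_sub (hint hF L) (hint hF.neg L)]
    have hpt : ∀ x, ((max (F x) 0 : ℝ) : ℂ) * Complex.exp (L x * Complex.I) -
        ((max ((-F) x) 0 : ℝ) : ℂ) * Complex.exp (L x * Complex.I) =
        ((F x * Real.cos (L x) : ℝ) : ℂ) + ((F x * Real.sin (L x) : ℝ) : ℂ) * Complex.I := by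
      intro x
      rw [← sub_mul, ← Complex.ofReal_sub, Pi.neg_apply,
        max_zero_sub_max_neg_zero_eq_self, Complex.exp_mul_I]
      push_cast
      ring
    have hc : ∀ g : X → ℝ, IsFCb1 g → Integrable (fun x => F x * g x) ν := fun g hg => by
      obtain ⟨C, hC⟩ := hg.bddC1.bdd
      exact hF.mul_bdd hg.bddC1.continuous.aestronglyMeasurable (ae_of_all _ hC)
    simp only [hpt]
    rw [integral_add (hc _ (.cos L)).ofReal ((hc _ (.sin L)).ofReal.mul_const _),
      integral_mul_const, integral_complex_ofReal, integral_complex_ofReal, h _ (.cos L),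
      h _ (.sin L)]
    simp
  have hae := (withDensity_eq_iff (hm hF) (hm hF.neg) (hfin hF)).1 heq
  filter_upwards [hae] with x hx
  rcases le_total (F x) 0 with h0 | h0
  · rw [ENNReal.ofReal_of_nonpos h0, eq_comm, ENNReal.ofReal_eq_zero, Pi.neg_apply] at hx
    simp only [Pi.zero_apply]
    linarith
  · rw [ENNReal.ofReal_of_nonpos (p := (-F) x) (by simpa using h0), ENNReal.ofReal_eq_zero] at hx
    exact le_antisymm hx h0

end Separation

/-! ### Closability -/

section Closability

/-- An adjoint relation for cylindrical functions extends to the closure of the graph of `D_H`. -/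
theorem integral_inner_eq_of_mem_closure_cylGraph {X : Type*} [NormedAddCommGroup X]
    [NormedSpace ℝ X] [MeasurableSpace X] {Q : NonnegSymmOp X} {ν : Measure X} {p q : ℝ≥0∞}
    [Fact (1 ≤ p)] [Fact (1 ≤ q)] [ENNReal.HolderConjugate p q] {m R : X → ℝ} {h : RKHS Q}
    (hm : MemLp m q ν) (hR : MemLp R q ν)
    (hadj : ∀ f : X → ℝ, IsFCb1 f →
      ∫ x, inner ℝ (DH Q f x) h * m x ∂ν = ∫ x, f x * R x ∂ν)
    {w : Lp ℝ p ν × Lp (RKHS Q) p ν} (hw : w ∈ (cylGraph Q ν p).topologicalClosure) :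
    ∫ x, inner ℝ (w.2 x) h * m x ∂ν = ∫ x, w.1 x * R x ∂ν := by
  let B₁ : RKHS Q →L[ℝ] ℝ →L[ℝ] ℝ :=
    (ContinuousLinearMap.mul ℝ ℝ).comp (innerSL ℝ h)
  let Λ₁ : Lp (RKHS Q) p ν →L[ℝ] ℝ := (B₁.lpPairing ν p q).flip (hm.toLp m)
  let Λ₂ : Lp ℝ p ν →L[ℝ] ℝ := ((ContinuousLinearMap.mul ℝ ℝ).lpPairing ν p q).flip (hR.toLp R)
  have hΛ₁ : ∀ G, Λ₁ G = ∫ x, inner ℝ (G x) h * m x ∂ν := by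
    intro G
    refine (B₁.lpPairing_eq_integral G (hm.toLp m)).trans (integral_congr_ae ?_)
    filter_upwards [hm.coeFn_toLp] with x hx
    rw [hx, real_inner_comm]
    rfl
  have hΛ₂ : ∀ F, Λ₂ F = ∫ x, F x * R x ∂ν := by
    intro F
    refine ((ContinuousLinearMap.mul ℝ ℝ).lpPairing_eq_integral F (hR.toLp R)).trans
      (integral_congr_ae ?_)
    filter_upwards [hR.coeFn_toLp] with x hx
    rw [hx]
    rfl
  rw [← hΛ₁, ← hΛ₂]
  refine closure_minimal (t := {w : Lp ℝ p ν × Lp (RKHS Q) p ν | Λ₁ w.2 = Λ₂ w.1}) ?_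
    (isClosed_eq (Λ₁.continuous.comp continuous_snd) (Λ₂.continuous.comp continuous_fst)) hw
  rintro w ⟨f, hf, hf1, hf2⟩
  rw [Set.mem_ofPred_eq, hΛ₁, hΛ₂]
  refine (Eq.trans ?_ (hadj f hf)).trans ?_ <;> refine integral_congr_ae ?_
  · filter_upwards [hf2] with x hx
    rw [hx]
  · filter_upwards [hf1] with x hx
    rw [hx]

variable {X : Type*} [NormedAddCommGroup X] [NormedSpace ℝ X] [CompleteSpace X]
  [SecondCountableTopology X] [MeasurableSpace X] [BorelSpace X]
  {Q Qinf : NonnegSymmOp X} {μ : Measure X} {U : X → EReal}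

/-- Integration by parts for the weighted measure: cutting off large values of `|U|` by `ψ(U)`
turns the test function `g` into one for which `D_H` has an adjoint in `L^q`. -/
theorem WeightAssumption.exists_adjoint (hU : WeightAssumption Q μ U)
    (hμ : IsCentredGaussian μ Qinf.toCLM)
    (hnd : ∀ xs : StrongDual ℝ X, xs ≠ 0 → 0 < xs (Qinf.toCLM xs))
    {q : ℝ≥0∞} [Fact (1 ≤ q)] (hq : q ≠ ∞) {g : X → ℝ} (hg : BddC1 g) {ψ : ℝ → ℝ}
    (hψ : ContDiff ℝ 1 ψ) {M : ℝ} (hM : ∀ t, M < |t| → ψ t = 0) {h : RKHS Q}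
    (hh : h ∈ rangeDirections Q Qinf) :
    ∃ R : X → ℝ, MemLp R q (weightedMeasure μ U) ∧ ∀ f : X → ℝ, BddC1 f →
      ∫ x, inner ℝ (DH Q f x) h * (g x * ψ (U x).toReal) ∂weightedMeasure μ U =
        ∫ x, f x * R x ∂weightedMeasure μ U := by
  have := hμ.isGaussian
  obtain ⟨ys, hys⟩ := hh
  obtain ⟨V, hV, hIBP⟩ := exists_gradient_integral_DH hμ hnd (hU.sobolev q hq)
  have hψ0 : Continuous ψ := hψ.continuous
  have hψ1 : Continuous (deriv ψ) := hψ.continuous_deriv le_rfl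
  have hM' : ∀ t, M < |t| → deriv ψ t = 0 := fun t ht => by
    have h1 : ψ =ᶠ[𝓝 t] fun _ => 0 := by
      filter_upwards [(isOpen_lt continuous_const continuous_abs).mem_nhds ht] with s hs using hM s hs
    rw [h1.deriv_eq, deriv_const]
  have hcpt : ∀ {φ : ℝ → ℝ}, Continuous φ → (∀ t, M < |t| → φ t = 0) → ∃ C, ∀ t, |φ t| ≤ C := by
    intro φ hφ h0
    refine hφ.bounded_above_of_compact_support
      (HasCompactSupport.intro (isCompact_Icc (a := -M) (b := M)) fun t ht => h0 t ?_)
    rw [Set.mem_Icc, ← abs_le, not_le] at ht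
    exact ht
  -- the cut-off of the density `e^{-U}`
  set χ : ℝ → ℝ := fun t => ψ t * Real.exp (-t) with hχdef
  have hχ : ContDiff ℝ 1 χ := hψ.mul (Real.contDiff_exp.comp contDiff_neg)
  have hχd : deriv χ = fun t => (deriv ψ t - ψ t) * Real.exp (-t) := by
    funext t
    have h1 := ((hψ.differentiable one_ne_zero) t).hasDerivAt.mul ((hasDerivAt_neg t).exp)
    refine h1.deriv.trans ?_
    ring
  obtain ⟨C, hC⟩ := hcpt hχ.continuous fun t ht => by simp [hχdef, hM t ht]
  obtain ⟨D, hD⟩ := hcpt (hχ.continuous_deriv le_rfl) fun t ht => by simp [hχd, hM t ht, hM' t ht]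
  obtain ⟨Cψ, hCψ⟩ := hcpt hψ0 hM
  obtain ⟨Dψ, hDψ⟩ := hcpt (hψ1.sub hψ0) fun t ht => by simp [hM t ht, hM' t ht]
  obtain ⟨Cg, hCg⟩ := hg.bdd
  obtain ⟨Dg, hDg⟩ := hg.bdd_DH Q
  have hum : AEStronglyMeasurable (fun x => (U x).toReal) μ :=
    hU.measurable.ereal_toReal.aestronglyMeasurable
  have mψ := hψ0.comp_aestronglyMeasurable hum
  have mψ' := (hψ1.sub hψ0).comp_aestronglyMeasurable hum
  have mg := hg.continuous.aestronglyMeasurable (μ := μ)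
  have hCg0 : 0 ≤ Cg := (abs_nonneg _).trans (hCg 0)
  have hCψ0 : 0 ≤ Cψ := (abs_nonneg _).trans (hCψ 0)
  refine ⟨fun x => g x * ψ (U x).toReal * ys x - ψ (U x).toReal * inner ℝ (DH Q g x) h -
    g x * (deriv ψ (U x).toReal - ψ (U x).toReal) * inner ℝ (V x) h, ?_, fun f hf => ?_⟩
  · refine hU.memLp_of_support (M := M) (MemLp.sub (MemLp.sub ?_ ?_) ?_) fun x hx => by
      simp [hM _ hx, hM' _ hx]
    · refine (IsGaussian.memLp_dual μ ys q hq).of_le_mul (c := Cg * Cψ)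
        ((mg.mul mψ).mul ys.continuous.aestronglyMeasurable) (ae_of_all _ fun x => ?_)
      rw [norm_mul, norm_mul]
      gcongr
      exacts [hCg x, hCψ _]
    · refine MemLp.of_bound
        (mψ.mul ((hg.continuous_DH Q).inner continuous_const).aestronglyMeasurable)
        (Cψ * (Dg * ‖h‖)) (ae_of_all _ fun x => ?_)
      rw [norm_mul]
      refine mul_le_mul (hCψ _) ((norm_inner_le_norm _ _).trans ?_) (norm_nonneg _) hCψ0
      gcongr
      exact hDg x
    · refine (hV.inner_const (𝕜 := ℝ) h).of_le_mul (c := Cg * Dψ)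
        ((mg.mul mψ').mul (hV.inner_const h).1) (ae_of_all _ fun x => ?_)
      rw [norm_mul, norm_mul]
      gcongr
      exacts [hCg x, hDψ _]
  · rw [hU.integral_eq, hU.integral_eq]
    have h1 := hIBP f g χ C D h ys hf hg hχ hC hD hys
    rw [hχd] at h1
    simp only [hχdef] at h1
    refine (Eq.trans ?_ h1).trans ?_ <;> refine integral_congr_ae (ae_of_all _ fun x => ?_) <;>
    · simp only
      ring

variable {p q : ℝ≥0∞} [Fact (1 ≤ p)] [Fact (1 ≤ q)]

/-- The adjoint relation passes to the closure of the graph, so that a gradient which is a limit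
along functions tending to zero vanishes when tested against `g ψ(U) h`. -/
theorem WeightAssumption.integral_inner_eq_zero (hU : WeightAssumption Q μ U)
    (hμ : IsCentredGaussian μ Qinf.toCLM)
    (hnd : ∀ xs : StrongDual ℝ X, xs ≠ 0 → 0 < xs (Qinf.toCLM xs))
    [ENNReal.HolderConjugate p q] (hq : q ≠ ∞) {g : X → ℝ} (hg : BddC1 g) {ψ : ℝ → ℝ}
    (hψ : ContDiff ℝ 1 ψ) {M C : ℝ} (hM : ∀ t, M < |t| → ψ t = 0) (hC : ∀ t, |ψ t| ≤ C)
    {h : RKHS Q} (hh : h ∈ rangeDirections Q Qinf)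
    {G : Lp (RKHS Q) p (weightedMeasure μ U)}
    (hG : (0, G) ∈ (cylGraph Q (weightedMeasure μ U) p).topologicalClosure) :
    ∫ x, inner ℝ (G x) h * (g x * ψ (U x).toReal) ∂weightedMeasure μ U = 0 := by
  have := isFiniteMeasure_weightedMeasure hμ hU
  obtain ⟨R, hR, hadj⟩ := hU.exists_adjoint hμ hnd hq hg hψ hM hh
  obtain ⟨Cg, hCg⟩ := hg.bdd
  have hm : MemLp (fun x => g x * ψ (U x).toReal) q (weightedMeasure μ U) := by
    refine MemLp.of_bound (hg.continuous.aestronglyMeasurable.mul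
      (hψ.continuous.comp_aestronglyMeasurable
        hU.measurable.ereal_toReal.aestronglyMeasurable)) (Cg * C) (ae_of_all _ fun x => ?_)
    rw [Real.norm_eq_abs, abs_mul]
    exact mul_le_mul (hCg x) (hC _) (abs_nonneg _) ((abs_nonneg _).trans (hCg 0))
  rw [integral_inner_eq_of_mem_closure_cylGraph hm hR (fun f hf => hadj f hf.bddC1) hG]
  refine integral_eq_zero_of_ae ?_
  filter_upwards [Lp.coeFn_zero ℝ p (weightedMeasure μ U)] with x hx
  change (0 : Lp ℝ p (weightedMeasure μ U)) x * R x = 0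
  rw [hx, Pi.zero_apply, zero_mul]

/-- The closure of the graph of `D_H` in `L^p(ν_∞)` is the graph of an operator. -/
theorem WeightAssumption.eq_zero_of_mem_closure (hU : WeightAssumption Q μ U)
    (hμ : IsCentredGaussian μ Qinf.toCLM)
    (hnd : ∀ xs : StrongDual ℝ X, xs ≠ 0 → 0 < xs (Qinf.toCLM xs))
    (hdense : Dense (rangeDirections Q Qinf : Set (RKHS Q)))
    [ENNReal.HolderConjugate p q] (hq : q ≠ ∞) {G : Lp (RKHS Q) p (weightedMeasure μ U)}
    (hG : (0, G) ∈ (cylGraph Q (weightedMeasure μ U) p).topologicalClosure) : G = 0 := by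
  have := isFiniteMeasure_weightedMeasure hμ hU
  have hGi : Integrable G (weightedMeasure μ U) := (Lp.memLp G).integrable Fact.out
  have hrange : ∀ h ∈ rangeDirections Q Qinf, ∀ᵐ x ∂weightedMeasure μ U, inner ℝ (G x) h = 0 := by
    intro h hh
    -- `ψ n` equals `1` on `[-(n + 1), n + 1]`, so that the cut-offs exhaust the finite values of `U`
    let ψ : ℕ → ContDiffBump (0 : ℝ) := fun n =>
      ⟨n + 1, n + 2, by positivity, by linarith⟩
    have h1 : ∀ n, ∀ᵐ x ∂weightedMeasure μ U, inner ℝ (G x) h * ψ n (U x).toReal = 0 := by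
      intro n
      have hψb : ∀ t, |ψ n t| ≤ 1 := fun t => by
        rw [abs_of_nonneg (ψ n).nonneg]; exact (ψ n).le_one
      refine ae_eq_zero_of_forall_integral_mul_eq_zero
        ((hGi.inner_const h).mul_bdd (c := 1) ((ψ n).continuous.comp_aestronglyMeasurable
          hU.measurable.ereal_toReal.aestronglyMeasurable) (ae_of_all _ fun x => hψb _))
        fun g hg => ?_
      have h2 := hU.integral_inner_eq_zero hμ hnd hq hg.bddC1 (ψ n).contDiff (M := n + 2)
        (fun t ht => (ψ n).zero_of_le_dist (by rw [Real.dist_0_eq_abs]; exact ht.le)) hψb hh hG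
      refine (integral_congr_ae (ae_of_all _ fun x => ?_)).trans h2
      ring
    filter_upwards [ae_all_iff.2 h1] with x hx
    obtain ⟨n, hn⟩ := exists_nat_ge |(U x).toReal|
    have h3 : ψ n (U x).toReal = 1 := (ψ n).one_of_mem_closedBall (by
      rw [Metric.mem_closedBall, Real.dist_0_eq_abs]
      exact hn.trans (by simp [ψ]))
    simpa [h3] using hx n
  have hall : ∀ h : RKHS Q, ∀ᵐ x ∂weightedMeasure μ U, inner ℝ (G x) h = 0 := by
    intro h
    obtain ⟨w, hw, hlim⟩ := mem_closure_iff_seq_limit.1 (hdense h)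
    filter_upwards [ae_all_iff.2 fun n => hrange (w n) (hw n)] with x hx
    refine tendsto_nhds_unique (tendsto_const_nhds.inner hlim) ?_
    simp only [hx]
    exact tendsto_const_nhds
  -- `H` need not be known to be separable, but `G` has an essentially separable range
  obtain ⟨t, ht, htG⟩ := (Lp.aestronglyMeasurable G).isSeparable_ae_range
  refine Lp.eq_zero_iff_ae_eq_zero.2
    (ae_eq_zero_of_forall_dual_of_isSeparable ℝ ht (fun c => ?_) htG)
  filter_upwards [hall ((InnerProductSpace.toDual ℝ (RKHS Q)).symm c)] with x hx
  rw [real_inner_comm, InnerProductSpace.toDual_symm_apply] at hx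
  exact hx

end Closability

/-! ### Completeness of the Sobolev spaces -/

section Completeness

variable {X : Type*} [NormedAddCommGroup X] [NormedSpace ℝ X] [MeasurableSpace X]
  {Q : NonnegSymmOp X} {γ : Measure X} {p : ℝ≥0∞} [Fact (1 ≤ p)]

theorem W1p.exists_of_tendsto (hcl : (DHLp Q γ p).IsClosable) {f : ℕ → W1p Q γ p} {a : Lp ℝ p γ}
    {b : Lp (RKHS Q) p γ} (ha : Tendsto (fun n => (f n).toLp) atTop (𝓝 a))
    (hb : Tendsto (fun n => (f n).grad) atTop (𝓝 b)) :
    ∃ g : W1p Q γ p, g.toLp = a ∧ g.grad = b := by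
  have h1 : (a, b) ∈ (DHLp Q γ p).closure.graph :=
    hcl.closure_isClosed.mem_of_tendsto (ha.prodMk_nhds hb)
      (Eventually.of_forall fun n => (DHLp Q γ p).closure.mem_graph (f n))
  obtain ⟨y, hy1, hy2⟩ := (LinearPMap.mem_graph_iff _).1 h1
  exact ⟨y, hy1, hy2⟩

theorem W1p.completeSpace (hcl : (DHLp Q γ p).IsClosable) : CompleteSpace (W1p Q γ p) := by
  refine Metric.complete_of_cauchySeq_tendsto fun f hf => ?_
  have h1 : CauchySeq fun n => (f n).toLp := by
    refine Metric.cauchySeq_iff'.2 fun ε hε => (Metric.cauchySeq_iff'.1 hf ε hε).imp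
      fun N hN n hn => lt_of_le_of_lt ?_ (hN n hn)
    rw [dist_eq_norm, dist_eq_norm, W1p.norm_def, map_sub]
    exact le_add_of_nonneg_right (norm_nonneg _)
  have h2 : CauchySeq fun n => (f n).grad := by
    refine Metric.cauchySeq_iff'.2 fun ε hε => (Metric.cauchySeq_iff'.1 hf ε hε).imp
      fun N hN n hn => lt_of_le_of_lt ?_ (hN n hn)
    rw [dist_eq_norm, dist_eq_norm, W1p.norm_def, map_sub (W1p.grad)]
    exact le_add_of_nonneg_left (norm_nonneg _)
  obtain ⟨a, ha⟩ := cauchySeq_tendsto_of_complete h1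
  obtain ⟨b, hb⟩ := cauchySeq_tendsto_of_complete h2
  obtain ⟨g, rfl, rfl⟩ := W1p.exists_of_tendsto hcl ha hb
  refine ⟨g, tendsto_iff_norm_sub_tendsto_zero.2 ?_⟩
  simpa [W1p.norm_def] using (tendsto_iff_norm_sub_tendsto_zero.1 ha).add
    (tendsto_iff_norm_sub_tendsto_zero.1 hb)

theorem W12.norm_sq (f : W12 Q γ) :
    ‖f‖ ^ 2 = ‖f.toW1p.toLp‖ ^ 2 + ‖f.toW1p.grad‖ ^ 2 := by
  rw [← real_inner_self_eq_norm_sq, W12.inner_def, W12.integral_mul, ← L2.inner_def,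
    real_inner_self_eq_norm_sq, real_inner_self_eq_norm_sq]

theorem W12.completeSpace (hcl : (DHLp Q γ 2).IsClosable) : CompleteSpace (W12 Q γ) := by
  refine Metric.complete_of_cauchySeq_tendsto fun f hf => ?_
  have h1 : CauchySeq fun n => (f n).toW1p.toLp := by
    refine Metric.cauchySeq_iff'.2 fun ε hε => (Metric.cauchySeq_iff'.1 hf ε hε).imp
      fun N hN n hn => lt_of_le_of_lt ?_ (hN n hn)
    rw [dist_eq_norm, dist_eq_norm, ← map_sub, ← map_sub]
    refine le_of_sq_le_sq ?_ (norm_nonneg _)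
    rw [W12.norm_sq]
    exact le_add_of_nonneg_right (sq_nonneg _)
  have h2 : CauchySeq fun n => (f n).toW1p.grad := by
    refine Metric.cauchySeq_iff'.2 fun ε hε => (Metric.cauchySeq_iff'.1 hf ε hε).imp
      fun N hN n hn => lt_of_le_of_lt ?_ (hN n hn)
    rw [dist_eq_norm, dist_eq_norm, ← map_sub, ← map_sub]
    refine le_of_sq_le_sq ?_ (norm_nonneg _)
    rw [W12.norm_sq]
    exact le_add_of_nonneg_left (sq_nonneg _)
  obtain ⟨a, ha⟩ := cauchySeq_tendsto_of_complete h1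
  obtain ⟨b, hb⟩ := cauchySeq_tendsto_of_complete h2
  obtain ⟨g, hga, hgb⟩ := W1p.exists_of_tendsto hcl ha hb
  subst hga hgb
  refine ⟨W12.toW1p.symm g, tendsto_iff_norm_sub_tendsto_zero.2 ?_⟩
  have h3 := (((tendsto_iff_norm_sub_tendsto_zero.1 ha).pow 2).add
    ((tendsto_iff_norm_sub_tendsto_zero.1 hb).pow 2)).sqrt
  simp only [ne_eq, OfNat.ofNat_ne_zero, not_false_eq_true, zero_pow, add_zero, Real.sqrt_zero]
    at h3
  refine h3.congr fun n => ?_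
  rw [← Real.sqrt_sq (norm_nonneg (f n - W12.toW1p.symm g)), W12.norm_sq]
  simp

end Completeness

end WeightedOU

end

theorem mainTheorem2 {X : Type*} [NormedAddCommGroup X] [NormedSpace ℝ X] [CompleteSpace X]
    [TopologicalSpace.SeparableSpace X] [MeasurableSpace X] [BorelSpace X]
    (Q Qinf : WeightedOU.NonnegSymmOp X)
    (A : X →ₗ.[ℝ] X) (T : ℝ≥0 → X →L[ℝ] X)
    (hT : WeightedOU.IsContractionSemigroup T) (hA : WeightedOU.IsGenerator A T)
    (μ : Measure X) (hμ : WeightedOU.CovarianceAssumption Q Qinf T μ)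
    (hH : WeightedOU.AnalyticityAssumption Q Qinf A)
    (U : X → EReal) (hU : WeightedOU.WeightAssumption Q μ U) :
    (∀ (p : ℝ≥0∞) [Fact (1 ≤ p)], 1 < p → p ≠ ∞ →
      (∀ f : X → ℝ, WeightedOU.IsFCb1 f →
        MemLp f p (WeightedOU.weightedMeasure μ U) ∧
        MemLp (WeightedOU.DH Q f) p (WeightedOU.weightedMeasure μ U)) ∧
      (WeightedOU.DHLp Q (WeightedOU.weightedMeasure μ U) p).graph =
        WeightedOU.cylGraph Q (WeightedOU.weightedMeasure μ U) p ∧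
      (WeightedOU.DHLp Q (WeightedOU.weightedMeasure μ U) p).IsClosable ∧
      CompleteSpace (WeightedOU.W1p Q (WeightedOU.weightedMeasure μ U) p)) ∧
    CompleteSpace (WeightedOU.W12 Q (WeightedOU.weightedMeasure μ U)) := by
  have : SecondCountableTopology X := UniformSpace.secondCountable_of_separable X
  have hdense := WeightedOU.dense_rangeDirections hT hA hμ.weak_limit hH
  have hfin := WeightedOU.isFiniteMeasure_weightedMeasure hμ.gaussian hU
  set ν := WeightedOU.weightedMeasure μ U with hν
  have hzero : ∀ (p : ℝ≥0∞) [Fact (1 ≤ p)], 1 < p →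
      ∀ w ∈ (WeightedOU.cylGraph Q ν p).topologicalClosure, w.1 = 0 → w.2 = 0 := by
    rintro p _ hp ⟨F, G⟩ hw rfl
    -- the conjugate exponent is finite because `p > 1`
    have hpq : ENNReal.HolderConjugate p p.conjExponent := inferInstance
    have hq : Fact (1 ≤ p.conjExponent) := ⟨ENNReal.HolderConjugate.one_le p.conjExponent p⟩
    exact hU.eq_zero_of_mem_closure hμ.gaussian hμ.nondegenerate hdense
      (q := p.conjExponent)
      ((ENNReal.HolderConjugate.ne_top_iff_ne_one p.conjExponent p).2 hp.ne') hw
  have hgraph : ∀ (p : ℝ≥0∞) [Fact (1 ≤ p)], 1 < p →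
      (WeightedOU.DHLp Q ν p).graph = WeightedOU.cylGraph Q ν p := fun p _ hp =>
    Submodule.toLinearPMap_graph_eq _ fun w hw =>
      hzero p hp w ((WeightedOU.cylGraph Q ν p).le_topologicalClosure hw)
  have hclos : ∀ (p : ℝ≥0∞) [Fact (1 ≤ p)], 1 < p → (WeightedOU.DHLp Q ν p).IsClosable := by
    intro p _ hp
    refine ⟨(WeightedOU.cylGraph Q ν p).topologicalClosure.toLinearPMap, ?_⟩
    rw [hgraph p hp, Submodule.toLinearPMap_graph_eq _ (hzero p hp)]
  exact ⟨fun p _ hp _ => ⟨fun f hf => ⟨hf.memLp, hf.memLp_DH⟩, hgraph p hp, hclos p hp,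
    WeightedOU.W1p.completeSpace (hclos p hp)⟩,
    WeightedOU.W12.completeSpace (hclos 2 (by norm_num))⟩
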